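/- For real $x\ge y\ge 2$ and an integer $k\ge 1$, let $\nu(n,y)$ denote the number of distinct primes $p\le y$ dividing the positive integer $n$, and let $N_k(x,y)$ be the number of positive integers $n\le x$ with $\nu(n,y)=k$. Write $\log_2 y=\log\log y$. Theorem 1.4. Let $c\in\,]0,1[$ and $\kappa>0$ be fixed. There exist constants $A,B>0$ and $y_0\ge 2$, depending only on $c$ and $\kappa$, such that for all real $x\ge y$ and all integers $k$ with $2\le y\le x^{1-c}$ and $1\le k\le(\log_2 y)/\kappa$ we have $$N_k(x,y)\le B\,\frac{x(\log_2 y)^k}{k!\,\log y},$$ and, provided that $y\ge y_0$ or $N_k(x,y)\ge 1$, also $$A\,\frac{x(\log_2 y)^k}{k!\,\log y}\le N_k(x,y).$$ -/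

import Mathlib

/-- `ν(n, y)`: the number of prime factors of `n` not exceeding `y`, counted without
multiplicity. -/
noncomputable def smallOmega (n : ℕ) (y : ℝ) : ℕ :=
  (n.primeFactors.filter (fun p : ℕ => (p : ℝ) ≤ y)).card

/-- `N_k(x, y)`: the number of positive integers `n ≤ x` with `ν(n, y) = k`. -/
noncomputable def localCount (k : ℕ) (x y : ℝ) : ℕ :=
  ((Finset.Icc 1 ⌊x⌋₊).filter (fun n : ℕ => smallOmega n y = k)).card

/-- The comparison function `x (log log y)^k / (k! log y)`. -/
noncomputable def localMain (k : ℕ) (x y : ℝ) : ℝ :=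
  x * Real.log (Real.log y) ^ k / ((k.factorial : ℝ) * Real.log y)

open Finset

/-! Write L = log log y. An integer with ν(n, y) = k splits into a part built from k primes p ≤ y
and a part free of such primes. So the sum of 1/n over n ≤ x with ν(n, y) = k is controlled by the
k-th elementary symmetric function of the 1/p, p ≤ y, times a factor of order log x / log y. By
Mertens-type bounds the former is at most (L + O(1))^k / k!, and k ≤ L/κ makes this O(L^k / k!).

Counts and reciprocal sums are linked by log n = ∑_{d ∣ n} Λ(d) with n = d m. Above, Chebyshev gives
ψ(x/m) ≪ x/m, and removing a prime power lowers ν by at most one (`localCount_mul_log_le`). Below,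
only primes d > y are kept; they leave ν unchanged (`mul_recipSum_le_sum_log`).

For large y the reciprocal sum is bounded below by products ab, with a ≤ y^c a product of k distinct
primes ≤ y and b free of primes ≤ y. The a are built from primes in (T, y^ε]: large T makes ∑ 1/p²
small, so that the symmetric function is comparable to its power-sum bound, and small ε lets a
Markov inequality discard a > y^c (`exists_sum_prod_inv_ge`). For bounded y, one solution n yields
an arithmetic progression of solutions. -/

/-! ### Elementary symmetric functions. -/

theorem sum_powersetCard_succ_sum {ι : Type*} [DecidableEq ι] (P : Finset ι)
    (f : Finset ι → ι → ℝ) (k : ℕ) :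
    ∑ A ∈ P.powersetCard (k + 1), ∑ p ∈ A, f A p
      = ∑ B ∈ P.powersetCard k, ∑ p ∈ P \ B, f (insert p B) p := by
  rw [Finset.sum_sigma', Finset.sum_sigma']
  refine Finset.sum_bij' (fun a _ => ⟨a.1.erase a.2, a.2⟩) (fun b _ => ⟨insert b.2 b.1, b.2⟩)
    ?_ ?_ ?_ ?_ ?_
  · rintro ⟨A, p⟩ h
    simp only [mem_sigma, mem_powersetCard, mem_sdiff] at h ⊢
    obtain ⟨⟨hA, hc⟩, hp⟩ := h
    refine ⟨⟨(erase_subset _ _).trans hA, ?_⟩, hA hp, by simp⟩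
    rw [card_erase_of_mem hp, hc]; rfl
  · rintro ⟨B, p⟩ h
    simp only [mem_sigma, mem_powersetCard, mem_sdiff] at h ⊢
    obtain ⟨⟨hB, hc⟩, hp, hpB⟩ := h
    refine ⟨⟨insert_subset hp hB, ?_⟩, by simp⟩
    rw [card_insert_of_notMem hpB, hc]
  · rintro ⟨A, p⟩ h
    simp only [mem_sigma] at h
    simp [insert_erase h.2]
  · rintro ⟨B, p⟩ h
    simp only [mem_sigma, mem_sdiff] at h
    simp [erase_insert h.2.2]
  · rintro ⟨A, p⟩ h
    simp only [mem_sigma] at h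
    simp [insert_erase h.2]

/-- The elementary symmetric function of degree `k` of the values of `x` on `P`. -/
noncomputable def elemSymm {ι : Type*} (P : Finset ι) (x : ι → ℝ) (k : ℕ) : ℝ :=
  ∑ A ∈ P.powersetCard k, ∏ p ∈ A, x p

theorem elemSymm_nonneg {ι : Type*} (P : Finset ι) (x : ι → ℝ) (hx : ∀ p ∈ P, 0 ≤ x p) (k : ℕ) :
    0 ≤ elemSymm P x k :=
  sum_nonneg fun _ hA => prod_nonneg fun p hp => hx p ((mem_powersetCard.1 hA).1 hp)

theorem sum_prod_mul_sum_eq {ι : Type*} [DecidableEq ι] (P : Finset ι) (x g : ι → ℝ) (k : ℕ) :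
    ∑ A ∈ P.powersetCard (k + 1), (∏ p ∈ A, x p) * ∑ p ∈ A, g p
      = ∑ B ∈ P.powersetCard k, (∏ p ∈ B, x p) * ∑ p ∈ P \ B, x p * g p := by
  simp_rw [mul_sum]
  rw [sum_powersetCard_succ_sum P (fun A p => (∏ q ∈ A, x q) * g p)]
  refine sum_congr rfl fun B _ => sum_congr rfl fun p hp => ?_
  rw [prod_insert (mem_sdiff.1 hp).2]
  ring

/-- Drops the condition p ∉ B. Taking g = 1 bounds symmetric functions above, g = x bounds the
correction in the reverse inequality, and g = log p later serves as a Markov inequality. -/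
theorem sum_prod_mul_sum_le {ι : Type*} [DecidableEq ι] (P : Finset ι) (x g : ι → ℝ)
    (hx : ∀ p ∈ P, 0 ≤ x p) (hg : ∀ p ∈ P, 0 ≤ g p) (k : ℕ) :
    ∑ A ∈ P.powersetCard (k + 1), (∏ p ∈ A, x p) * ∑ p ∈ A, g p
      ≤ (∑ p ∈ P, x p * g p) * elemSymm P x k := by
  rw [sum_prod_mul_sum_eq, elemSymm, mul_sum]
  refine sum_le_sum fun B hB => ?_
  rw [mul_comm]
  refine mul_le_mul_of_nonneg_right ?_
    (prod_nonneg fun p hp => hx p ((mem_powersetCard.1 hB).1 hp))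
  exact sum_le_sum_of_subset_of_nonneg sdiff_subset
    fun p hp _ => mul_nonneg (hx p hp) (hg p hp)

theorem succ_mul_elemSymm {ι : Type*} [DecidableEq ι] (P : Finset ι) (x : ι → ℝ) (k : ℕ) :
    ((k : ℝ) + 1) * elemSymm P x (k + 1)
      = ∑ A ∈ P.powersetCard (k + 1), (∏ p ∈ A, x p) * ∑ _p ∈ A, (1 : ℝ) := by
  rw [elemSymm, mul_sum]
  refine sum_congr rfl fun A hA => ?_
  rw [sum_const, (mem_powersetCard.1 hA).2]
  simp [mul_comm]

theorem succ_mul_elemSymm_le {ι : Type*} [DecidableEq ι] (P : Finset ι) (x : ι → ℝ)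
    (hx : ∀ p ∈ P, 0 ≤ x p) (k : ℕ) :
    ((k : ℝ) + 1) * elemSymm P x (k + 1) ≤ (∑ p ∈ P, x p) * elemSymm P x k := by
  rw [succ_mul_elemSymm]
  simpa using sum_prod_mul_sum_le P x (fun _ => 1) hx (fun _ _ => zero_le_one) k

theorem elemSymm_zero {ι : Type*} (P : Finset ι) (x : ι → ℝ) : elemSymm P x 0 = 1 := by
  simp [elemSymm]

theorem factorial_mul_elemSymm_le {ι : Type*} [DecidableEq ι] (P : Finset ι) (x : ι → ℝ)
    (hx : ∀ p ∈ P, 0 ≤ x p) (k : ℕ) :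
    (k.factorial : ℝ) * elemSymm P x k ≤ (∑ p ∈ P, x p) ^ k := by
  induction k with
  | zero => simp [elemSymm_zero]
  | succ k ih =>
    have h := succ_mul_elemSymm_le P x hx k
    have hS : 0 ≤ ∑ p ∈ P, x p := sum_nonneg hx
    have hf : (0 : ℝ) ≤ k.factorial := by positivity
    calc ((k + 1).factorial : ℝ) * elemSymm P x (k + 1)
        = k.factorial * (((k : ℝ) + 1) * elemSymm P x (k + 1)) := by
          rw [Nat.factorial_succ]; push_cast; ring
      _ ≤ k.factorial * ((∑ p ∈ P, x p) * elemSymm P x k) := by gcongr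
      _ = (∑ p ∈ P, x p) * (k.factorial * elemSymm P x k) := by ring
      _ ≤ (∑ p ∈ P, x p) * (∑ p ∈ P, x p) ^ k := by gcongr
      _ = _ := by ring

theorem succ_succ_mul_elemSymm_ge {ι : Type*} [DecidableEq ι] (P : Finset ι) (x : ι → ℝ)
    (hx : ∀ p ∈ P, 0 ≤ x p) (k : ℕ) :
    (∑ p ∈ P, x p) * elemSymm P x (k + 1) - (∑ p ∈ P, x p ^ 2) * elemSymm P x k
      ≤ ((k : ℝ) + 2) * elemSymm P x (k + 2) := by
  have h1 : ((k : ℝ) + 2) * elemSymm P x (k + 2)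
      = (∑ p ∈ P, x p) * elemSymm P x (k + 1)
        - ∑ A ∈ P.powersetCard (k + 1), (∏ p ∈ A, x p) * ∑ p ∈ A, x p := by
    have := succ_mul_elemSymm P x (k + 1)
    rw [sum_prod_mul_sum_eq] at this
    push_cast at this
    rw [show (k : ℝ) + 2 = k + 1 + 1 by ring, this, elemSymm, mul_sum, ← sum_sub_distrib]
    refine sum_congr rfl fun A hA => ?_
    rw [← sum_sdiff (mem_powersetCard.1 hA).1]
    simp
    ring
  have h2 := sum_prod_mul_sum_le P x x hx hx k
  simp_rw [← pow_two] at h2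
  linarith

/-- Expanding the power of S, a tuple with a repeated index has one of (k+1)(k+2)/2 pairs of
positions coinciding, and each pair costs Q S^k. The induction adds these losses one factor at a
time. -/
theorem factorial_mul_elemSymm_ge {ι : Type*} [DecidableEq ι] (P : Finset ι) (x : ι → ℝ)
    (hx : ∀ p ∈ P, 0 ≤ x p) (k : ℕ) :
    (∑ p ∈ P, x p) ^ (k + 2)
        - (∑ p ∈ P, x p ^ 2) * (((k : ℝ) + 1) * (k + 2) / 2) * (∑ p ∈ P, x p) ^ k
      ≤ ((k + 2).factorial : ℝ) * elemSymm P x (k + 2) := by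
  set S := ∑ p ∈ P, x p with hSdef
  set Q := ∑ p ∈ P, x p ^ 2 with hQdef
  have hS : 0 ≤ S := sum_nonneg hx
  have hQ : 0 ≤ Q := sum_nonneg fun _ _ => sq_nonneg _
  have key : ∀ k : ℕ, (((k + 1).factorial : ℝ)) * S * elemSymm P x (k + 1)
      - ((k : ℝ) + 1) * Q * S ^ k ≤ ((k + 2).factorial : ℝ) * elemSymm P x (k + 2) := by
    intro k
    have h := succ_succ_mul_elemSymm_ge P x hx k
    have h2 := factorial_mul_elemSymm_le P x hx k
    rw [← hSdef] at h h2
    rw [← hQdef] at h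
    have hf : (0 : ℝ) ≤ (k + 1).factorial := by positivity
    have h3 := mul_le_mul_of_nonneg_left h hf
    have h4 : ((k + 1).factorial : ℝ) * (Q * elemSymm P x k) ≤ ((k : ℝ) + 1) * Q * S ^ k := by
      have := mul_le_mul_of_nonneg_left h2 (show 0 ≤ ((k : ℝ) + 1) * Q by positivity)
      rw [Nat.factorial_succ]; push_cast
      linarith
    have h5 : ((k + 2).factorial : ℝ) = ((k : ℝ) + 2) * (k + 1).factorial := by
      rw [Nat.factorial_succ (k + 1)]; push_cast; ring
    rw [h5]
    linarith
  induction k with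
  | zero =>
    have h := key 0
    have h1 : elemSymm P x 1 = S := by
      simp [elemSymm, powersetCard_one, hSdef]
    simp [h1] at h ⊢
    nlinarith
  | succ k ih =>
    have h := key (k + 1)
    have := mul_le_mul_of_nonneg_left ih hS
    push_cast at h ⊢
    have e1 : S ^ (k + 1 + 2) = S * S ^ (k + 2) := by ring
    have e2 : S ^ (k + 1) = S * S ^ k := by ring
    rw [e1, e2]
    rw [e2] at h
    rw [show k + 1 + 2 = k + 3 from rfl]
    rw [show k + 1 + 1 = k + 2 from rfl, show k + 1 + 2 = k + 3 from rfl] at h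
    nlinarith

/-! ### Euler products and bounds of Mertens and Chebyshev type. -/

theorem inv_one_sub_inv_le_exp {p : ℕ} (hp : p.Prime) :
    (1 - (p : ℝ)⁻¹)⁻¹ ≤ Real.exp (1 / ((p : ℝ) - 1)) := by
  have h1 : (1 : ℝ) < p := by exact_mod_cast hp.one_lt
  have h2 : (1 - (p : ℝ)⁻¹)⁻¹ = 1 / ((p : ℝ) - 1) + 1 := by
    have : (p : ℝ) - 1 ≠ 0 := by linarith
    field_simp
    ring
  rw [h2]
  exact Real.add_one_le_exp _

theorem prod_inv_one_sub_inv_le_exp (S : Finset ℕ) (hS : ∀ p ∈ S, p.Prime) :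
    ∏ p ∈ S, (1 - (p : ℝ)⁻¹)⁻¹ ≤ Real.exp (∑ p ∈ S, 1 / ((p : ℝ) - 1)) := by
  rw [Real.exp_sum]
  refine prod_le_prod (fun p hp => ?_) fun p hp => inv_one_sub_inv_le_exp (hS p hp)
  have h1 : (1 : ℝ) < p := by exact_mod_cast (hS p hp).one_lt
  exact inv_nonneg.2 (sub_nonneg.2 (inv_le_one_of_one_le₀ h1.le))

theorem sum_inv_le_prod_of_factoredNumbers (S : Finset ℕ) (hS : ∀ p ∈ S, p.Prime) (F : Finset ℕ)
    (hF : ∀ n ∈ F, n ∈ Nat.factoredNumbers S) :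
    ∑ n ∈ F, (n : ℝ)⁻¹ ≤ ∏ p ∈ S, (1 - (p : ℝ)⁻¹)⁻¹ := by
  let f : ℕ →* ℝ :=
    { toFun := fun n => (n : ℝ)⁻¹
      map_one' := by simp
      map_mul' := fun a b => by push_cast; rw [mul_inv] }
  have hf : ∀ {p : ℕ}, p.Prime → ‖f p‖ < 1 := by
    intro p hp
    have h1 : (1 : ℝ) < p := by exact_mod_cast hp.one_lt
    change ‖(p : ℝ)⁻¹‖ < 1
    rw [Real.norm_of_nonneg (by positivity)]
    exact inv_lt_one_of_one_lt₀ h1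
  have h := (EulerProduct.summable_and_hasSum_factoredNumbers_prod_filter_prime_geometric hf S).2
  rw [filter_true_of_mem hS] at h
  have h2 := sum_le_hasSum (F.attach.map
    ⟨fun n => (⟨n.1, hF n.1 n.2⟩ : Nat.factoredNumbers S), fun a b hab => by
      apply Subtype.ext; simpa using hab⟩) (fun i _ => by
        change 0 ≤ ((i : ℕ) : ℝ)⁻¹
        positivity) h
  rw [sum_map] at h2
  rw [← sum_attach]
  exact h2

/-- A sieve adding one prime q at a time: a multiple of q counted in R is q m with m again counted
in R, so these terms sum to at most R/q, and removing them leaves at least (1 - 1/q) R. -/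
theorem sum_inv_le_rough_mul_prod (S : Finset ℕ) (hS : ∀ p ∈ S, p.Prime) (W : ℕ) :
    ∑ n ∈ Icc 1 W, (n : ℝ)⁻¹
      ≤ (∑ n ∈ Icc 1 W with ∀ p ∈ S, ¬ p ∣ n, (n : ℝ)⁻¹) * ∏ p ∈ S, (1 - (p : ℝ)⁻¹)⁻¹ := by
  induction S using Finset.induction_on with
  | empty => simp
  | insert q S hq ih =>
    have ih := ih fun p hp => hS p (mem_insert_of_mem hp)
    refine ih.trans ?_
    rw [prod_insert hq, ← mul_assoc]
    have hqp : q.Prime := hS q (mem_insert_self _ _)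
    have hq1 : (1 : ℝ) < q := by exact_mod_cast hqp.one_lt
    refine mul_le_mul_of_nonneg_right ?_ (prod_nonneg fun p hp => ?_)
    · set R := ∑ n ∈ Icc 1 W with ∀ p ∈ S, ¬ p ∣ n, (n : ℝ)⁻¹ with hR
      have hsplit : R = (∑ n ∈ Icc 1 W with ∀ p ∈ insert q S, ¬ p ∣ n, (n : ℝ)⁻¹)
          + ∑ n ∈ Icc 1 W with (∀ p ∈ S, ¬ p ∣ n) ∧ q ∣ n, (n : ℝ)⁻¹ := by
        rw [hR, ← sum_filter_add_sum_filter_not _ (fun n => ¬ q ∣ n), filter_filter, filter_filter]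
        congr 2
        · refine filter_congr fun n _ => ?_
          simp [and_comm]
        · simp
      have hdiv : ∑ n ∈ Icc 1 W with (∀ p ∈ S, ¬ p ∣ n) ∧ q ∣ n, (n : ℝ)⁻¹ ≤ (q : ℝ)⁻¹ * R := by
        rw [hR, mul_sum]
        have : ∀ n ∈ (Icc 1 W).filter (fun n => (∀ p ∈ S, ¬ p ∣ n) ∧ q ∣ n),
            (n : ℝ)⁻¹ = (q : ℝ)⁻¹ * ((n / q : ℕ) : ℝ)⁻¹ := by
          intro n hn
          obtain ⟨m, rfl⟩ := (mem_filter.1 hn).2.2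
          rw [Nat.mul_div_cancel_left _ hqp.pos]
          push_cast
          rw [mul_inv]
        rw [sum_congr rfl this]
        have hinj : Set.InjOn (fun n => n / q)
            ((Icc 1 W).filter (fun n => (∀ p ∈ S, ¬ p ∣ n) ∧ q ∣ n) : Set ℕ) := by
          intro a ha b hb hab
          have ha := (mem_filter.1 (mem_coe.1 ha)).2.2
          have hb := (mem_filter.1 (mem_coe.1 hb)).2.2
          exact Nat.div_left_inj ha hb |>.1 hab
        rw [← sum_image (g := fun n => n / q) (f := fun m : ℕ => (q : ℝ)⁻¹ * (m : ℝ)⁻¹) hinj]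
        refine sum_le_sum_of_subset_of_nonneg ?_ fun _ _ _ => by positivity
        intro m hm
        obtain ⟨n, hn, rfl⟩ := mem_image.1 hm
        rw [mem_filter, mem_Icc] at hn
        obtain ⟨⟨h1, h2⟩, h3, m, rfl⟩ := hn
        simp only [Nat.mul_div_cancel_left _ hqp.pos]
        rw [mem_filter, mem_Icc]
        refine ⟨⟨Nat.pos_of_ne_zero fun h => ?_, ?_⟩, fun p hp hpm => h3 p hp (hpm.mul_left _)⟩
        · simp [h] at h1
        · exact (Nat.le_mul_of_pos_left m hqp.pos).trans h2
      have hpos : 0 < 1 - (q : ℝ)⁻¹ := sub_pos.2 (inv_lt_one_of_one_lt₀ hq1)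
      rw [← div_eq_mul_inv, le_div_iff₀ hpos]
      linarith
    · have h1 : (1 : ℝ) < p := by exact_mod_cast (hS p (mem_insert_of_mem hp)).one_lt
      exact inv_nonneg.2 (sub_nonneg.2 (inv_le_one_of_one_le₀ h1.le))

theorem log_le_sum_inv {y : ℝ} (hy : 0 ≤ y) : Real.log y ≤ ∑ n ∈ Icc 1 ⌊y⌋₊, (n : ℝ)⁻¹ := by
  have := log_le_harmonic_floor y hy
  rw [harmonic_eq_sum_Icc] at this
  simpa using this

/-- The sum of `1 / (p - 1)` over the primes `p ≤ y`. -/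
noncomputable def primeSum (y : ℝ) : ℝ := ∑ p ∈ Nat.primesLE ⌊y⌋₊, 1 / ((p : ℝ) - 1)

theorem log_log_le_primeSum {y : ℝ} (hy : 1 < y) : Real.log (Real.log y) ≤ primeSum y := by
  have h1 := log_le_sum_inv (y := y) (by linarith)
  have hp : ∀ p ∈ Nat.primesLE ⌊y⌋₊, p.Prime := fun p hp => Nat.prime_of_mem_primesLE hp
  have h2 := sum_inv_le_prod_of_factoredNumbers _ hp (Icc 1 ⌊y⌋₊) (by
    intro n hn
    rw [mem_Icc] at hn
    refine Nat.mem_factoredNumbers_of_primeFactors_subset (by omega) fun p hp => ?_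
    rw [Nat.mem_primesLE]
    exact ⟨(Nat.le_of_mem_primeFactors hp).trans hn.2, Nat.prime_of_mem_primeFactors hp⟩)
  have h3 := prod_inv_one_sub_inv_le_exp _ hp
  rw [Real.log_le_iff_le_exp (Real.log_pos hy)]
  exact h1.trans (h2.trans h3)

/-- Upper half of Mertens' first theorem: ∑ Λ(n) ⌊N/n⌋ = log N! ≤ N log N, and dropping the floors
costs at most ψ(N). -/
theorem sum_log_div_le {y : ℝ} (hy : 1 ≤ y) :
    ∑ p ∈ Nat.primesLE ⌊y⌋₊, Real.log p / p ≤ Real.log y + (Real.log 4 + 4) := by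
  set N := ⌊y⌋₊ with hN
  have hN1 : 1 ≤ N := Nat.one_le_floor_iff _ |>.2 hy
  have hN0 : (0 : ℝ) < N := by exact_mod_cast hN1
  have h1 : ∑ p ∈ Nat.primesLE N, Real.log p / p
      ≤ ∑ n ∈ Ioc 0 N, ArithmeticFunction.vonMangoldt n / n := by
    rw [Nat.primesLE_eq_filter_Ioc_zero, sum_filter]
    refine sum_le_sum fun n _ => ?_
    split_ifs with h
    · rw [ArithmeticFunction.vonMangoldt_apply_prime h]
    · exact div_nonneg ArithmeticFunction.vonMangoldt_nonneg (Nat.cast_nonneg _)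
  have h2 : (N : ℝ) * ∑ n ∈ Ioc 0 N, ArithmeticFunction.vonMangoldt n / n
      ≤ (∑ n ∈ Ioc 0 N, ArithmeticFunction.vonMangoldt n * ((N / n : ℕ) : ℝ)) + Chebyshev.psi N := by
    rw [Chebyshev.psi, Nat.floor_natCast, ← sum_add_distrib, mul_sum]
    refine sum_le_sum fun n hn => ?_
    have hn0 : (0 : ℝ) < n := by exact_mod_cast (mem_Ioc.1 hn).1
    have : (N : ℝ) / n ≤ ((N / n : ℕ) : ℝ) + 1 := by
      rw [← Nat.floor_div_eq_div (K := ℝ)]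
      exact (Nat.lt_floor_add_one _).le
    calc (N : ℝ) * (ArithmeticFunction.vonMangoldt n / n)
        = ArithmeticFunction.vonMangoldt n * (N / n) := by ring
      _ ≤ ArithmeticFunction.vonMangoldt n * (((N / n : ℕ) : ℝ) + 1) :=
          mul_le_mul_of_nonneg_left this ArithmeticFunction.vonMangoldt_nonneg
      _ = _ := by ring
  have h3 : ∑ n ∈ Ioc 0 N, ArithmeticFunction.vonMangoldt n * ((N / n : ℕ) : ℝ)
      ≤ N * Real.log N := by
    rw [← ArithmeticFunction.sum_Ioc_mul_zeta_eq_sum, ArithmeticFunction.vonMangoldt_mul_zeta]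
    calc ∑ n ∈ Ioc 0 N, ArithmeticFunction.log n ≤ ∑ n ∈ Ioc 0 N, Real.log N := by
          refine sum_le_sum fun n hn => ?_
          rw [ArithmeticFunction.log_apply]
          rw [mem_Ioc] at hn
          exact Real.log_le_log (by exact_mod_cast hn.1) (by exact_mod_cast hn.2)
      _ = _ := by simp
  have h4 := Chebyshev.psi_le_const_mul_self hN0.le
  have h5 : Real.log N ≤ Real.log y := Real.log_le_log hN0 (Nat.floor_le (by linarith))
  have h6 : (N : ℝ) * ∑ p ∈ Nat.primesLE N, Real.log p / p
      ≤ N * (Real.log y + (Real.log 4 + 4)) := by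
    have := mul_le_mul_of_nonneg_left h1 hN0.le
    have := mul_le_mul_of_nonneg_left h5 hN0.le
    linarith
  exact le_of_mul_le_mul_left h6 hN0

theorem rpow_neg_succ_mul_le {σ : ℝ} (hσ : 0 < σ) {n : ℝ} (hn : 0 < n) :
    (n + 1) ^ (-(1 + σ)) * σ ≤ n ^ (-σ) - (n + 1) ^ (-σ) := by
  have hn1 : 0 < n + 1 := by linarith
  have h1 : n ^ (-σ) = (n + 1) ^ (-σ) * Real.exp (σ * Real.log ((n + 1) / n)) := by
    rw [Real.rpow_def_of_pos hn, Real.rpow_def_of_pos hn1, ← Real.exp_add,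
      Real.log_div hn1.ne' hn.ne']
    congr 1; ring
  have h2 : σ * (1 / (n + 1)) + 1 ≤ Real.exp (σ * Real.log ((n + 1) / n)) := by
    refine le_trans ?_ (Real.add_one_le_exp _)
    have := Real.one_sub_inv_le_log_of_pos (show 0 < (n + 1) / n by positivity)
    have e : 1 - ((n + 1) / n)⁻¹ = 1 / (n + 1) := by field_simp; ring
    rw [e] at this
    gcongr
  have h3 : (n + 1) ^ (-(1 + σ)) = (n + 1) ^ (-σ) * (1 / (n + 1)) := by
    rw [show -(1 + σ) = -σ - 1 by ring, Real.rpow_sub_one hn1.ne']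
    ring
  have h4 : 0 < (n + 1) ^ (-σ) := Real.rpow_pos_of_pos hn1 _
  rw [h1, h3]
  nlinarith [mul_le_mul_of_nonneg_left h2 h4.le]

theorem sum_rpow_neg_le {σ : ℝ} (hσ : 0 < σ) (N : ℕ) :
    ∑ n ∈ range (N + 2), (n : ℝ) ^ (-(1 + σ)) ≤ 1 + (1 - ((N : ℝ) + 1) ^ (-σ)) / σ := by
  induction N with
  | zero =>
    rw [sum_range_succ, sum_range_succ, sum_range_zero]
    simp only [Nat.cast_zero, Nat.cast_one, Real.one_rpow]
    -- The term n = 0 vanishes, since 0 to a nonzero power is 0.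
    rw [Real.zero_rpow (by linarith)]
    simp
  | succ N ih =>
    rw [sum_range_succ]
    have h := rpow_neg_succ_mul_le hσ (show (0 : ℝ) < (N : ℝ) + 1 by positivity)
    rw [← le_div_iff₀ hσ] at h
    push_cast
    rw [sub_div] at ih h ⊢
    rw [show (N : ℝ) + 2 = N + 1 + 1 by ring]
    linarith

/-- Compares exp u ≤ 1/(1 - u) with the Euler product of ζ(1 + σ) ≤ 1 + 1/σ. -/
theorem sum_prime_rpow_le {σ : ℝ} (hσ : 0 < σ) (N : ℕ) :
    ∑ p ∈ Nat.primesLE N, (p : ℝ) ^ (-(1 + σ)) ≤ Real.log (1 + 1 / σ) := by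
  let f : ℕ →* ℝ :=
    { toFun := fun n => (n : ℝ) ^ (-(1 + σ))
      map_one' := by simp
      map_mul' := fun a b => by
        push_cast; rw [Real.mul_rpow (Nat.cast_nonneg _) (Nat.cast_nonneg _)] }
  have hf0 : ∀ n, 0 ≤ f n := fun n => Real.rpow_nonneg (Nat.cast_nonneg _) _
  have hfs : Summable f := by
    change Summable fun n : ℕ => (n : ℝ) ^ (-(1 + σ))
    rw [Real.summable_nat_rpow]
    linarith
  have h1 := EulerProduct.prod_primesBelow_geometric_eq_tsum_smoothNumbers hfs (N + 1)
  have h2 : ∑' m : Nat.smoothNumbers (N + 1), f m ≤ ∑' m, f m :=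
    hfs.tsum_subtype_le _ _ hf0
  have h3 : ∑' m, f m ≤ 1 + 1 / σ := by
    refine Real.tsum_le_of_sum_range_le hf0 fun n => ?_
    calc ∑ i ∈ range n, f i ≤ ∑ i ∈ range (n + 2), f i :=
          sum_le_sum_of_subset_of_nonneg (range_mono (by omega)) fun i _ _ => hf0 i
      _ ≤ 1 + (1 - ((n : ℝ) + 1) ^ (-σ)) / σ := sum_rpow_neg_le hσ n
      _ ≤ 1 + 1 / σ := by
          have : 0 ≤ ((n : ℝ) + 1) ^ (-σ) := Real.rpow_nonneg (by positivity) _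
          gcongr
          linarith
  rw [Real.le_log_iff_exp_le (by positivity), Real.exp_sum]
  refine le_trans ?_ (h1.le.trans (h2.trans h3))
  change ∏ p ∈ Nat.primesLE N, _ ≤ ∏ p ∈ Nat.primesLE N, _
  refine prod_le_prod (fun _ _ => (Real.exp_pos _).le) fun p hp => ?_
  have hp1 : (1 : ℝ) < p := by exact_mod_cast (Nat.one_lt_of_mem_primesLE hp)
  have hlt : (p : ℝ) ^ (-(1 + σ)) < 1 := Real.rpow_lt_one_of_one_lt_of_neg hp1 (by linarith)
  change _ ≤ (1 - (p : ℝ) ^ (-(1 + σ)))⁻¹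
  rw [le_inv_comm₀ (Real.exp_pos _) (by linarith), ← Real.exp_neg]
  exact Real.one_sub_le_exp_neg _

/-- With σ = 1/log y, the inequality p^(-σ) ≥ 1 - σ log p replaces 1/p by p^(-1-σ), at the cost of σ
∑ (log p)/p = O(1). -/
theorem sum_prime_inv_le {y : ℝ} (hy : Real.exp 1 ≤ y) :
    ∑ p ∈ Nat.primesLE ⌊y⌋₊, 1 / (p : ℝ) ≤ Real.log (Real.log y) + 12 := by
  have hl : 1 ≤ Real.log y := by
    rwa [Real.le_log_iff_exp_le (lt_of_lt_of_le (Real.exp_pos _) hy)]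
  have hl0 : 0 < Real.log y := by linarith
  have hy1 : 1 ≤ y := by linarith [Real.add_one_le_exp 1]
  set σ := 1 / Real.log y with hσ
  have hσ0 : 0 < σ := by positivity
  have h1 := sum_prime_rpow_le hσ0 ⌊y⌋₊
  have h2 : Real.log (1 + 1 / σ) ≤ Real.log (Real.log y) + 1 := by
    rw [hσ, one_div_one_div]
    calc Real.log (1 + Real.log y) ≤ Real.log (2 * Real.log y) :=
          Real.log_le_log (by linarith) (by linarith)
      _ = Real.log 2 + Real.log (Real.log y) := Real.log_mul (by norm_num) hl0.ne'
      _ ≤ _ := by linarith [Real.log_two_lt_d9]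
  have h3 : ∑ p ∈ Nat.primesLE ⌊y⌋₊, 1 / (p : ℝ)
      ≤ ∑ p ∈ Nat.primesLE ⌊y⌋₊, ((p : ℝ) ^ (-(1 + σ)) + σ * (Real.log p / p)) := by
    refine sum_le_sum fun p hp => ?_
    have hp0 : (0 : ℝ) < p := by exact_mod_cast (Nat.prime_of_mem_primesLE hp).pos
    have e : (p : ℝ) ^ (-(1 + σ)) = Real.exp (-(σ * Real.log p)) * (1 / p) := by
      rw [show -(1 + σ) = -σ - 1 by ring, Real.rpow_sub_one hp0.ne', Real.rpow_def_of_pos hp0]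
      rw [show Real.log p * -σ = -(σ * Real.log p) by ring]
      ring
    rw [e]
    have := mul_le_mul_of_nonneg_right (Real.one_sub_le_exp_neg (σ * Real.log p))
      (show 0 ≤ 1 / (p : ℝ) by positivity)
    calc 1 / (p : ℝ) = (1 - σ * Real.log p) * (1 / p) + σ * (Real.log p / p) := by ring
      _ ≤ _ := by gcongr
  rw [sum_add_distrib, ← mul_sum] at h3
  have h4 : σ * ∑ p ∈ Nat.primesLE ⌊y⌋₊, Real.log p / p ≤ 11 := by
    have h5 := mul_le_mul_of_nonneg_left (sum_log_div_le hy1) hσ0.le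
    have h6 : σ * Real.log y = 1 := by rw [hσ]; field_simp
    have h7 : σ ≤ 1 := by rw [hσ, div_le_one hl0]; exact hl
    have h8 : Real.log 4 ≤ 4 - 1 := Real.log_le_sub_one_of_pos (by norm_num)
    have h9 : 0 ≤ Real.log 4 := Real.log_nonneg (by norm_num)
    nlinarith
  linarith

theorem sum_Ioc_inv_mul_pred_le (T N : ℕ) (hT : 1 ≤ T) :
    ∑ n ∈ Ioc T N, 1 / ((n : ℝ) * (n - 1)) ≤ 1 / T := by
  rcases le_total N T with h | h
  · rw [Ioc_eq_empty_of_le h]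
    simp
  · have : ∑ n ∈ Ioc T N, 1 / ((n : ℝ) * (n - 1)) = 1 / T - 1 / N := by
      induction N, h using Nat.le_induction with
      | base => simp
      | succ N hN ih =>
        rw [sum_Ioc_succ_top (by omega), ih]
        have h0 : (0 : ℝ) < N := by exact_mod_cast (by omega : 0 < N)
        have h1 : (0 : ℝ) < T := by exact_mod_cast (by omega : 0 < T)
        push_cast
        rw [add_sub_cancel_right]
        field_simp
        ring
    rw [this]
    have : (0 : ℝ) ≤ 1 / N := by positivity
    linarith

theorem primeSum_le_sum_inv_add_one (y : ℝ) :
    primeSum y ≤ ∑ p ∈ Nat.primesLE ⌊y⌋₊, 1 / (p : ℝ) + 1 := by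
  have h1 : primeSum y = ∑ p ∈ Nat.primesLE ⌊y⌋₊, 1 / (p : ℝ)
      + ∑ p ∈ Nat.primesLE ⌊y⌋₊, 1 / ((p : ℝ) * (p - 1)) := by
    rw [primeSum, ← sum_add_distrib]
    refine sum_congr rfl fun p hp => ?_
    have hp1 : (1 : ℝ) < p := by exact_mod_cast (Nat.one_lt_of_mem_primesLE hp)
    have : (p : ℝ) - 1 ≠ 0 := by linarith
    field_simp
    ring
  rw [h1]
  gcongr
  refine le_trans ?_ ((sum_Ioc_inv_mul_pred_le 1 ⌊y⌋₊ le_rfl).trans (by simp))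
  refine sum_le_sum_of_subset_of_nonneg (fun p hp => ?_) fun n hn _ => ?_
  · rw [mem_Ioc]
    exact ⟨Nat.one_lt_of_mem_primesLE hp, Nat.le_of_mem_primesLE hp⟩
  · have : (1 : ℝ) < n := by exact_mod_cast (mem_Ioc.1 hn).1
    have : 0 < (n : ℝ) - 1 := by linarith
    positivity

theorem primeSum_le {y : ℝ} (hy : Real.exp 1 ≤ y) :
    primeSum y ≤ Real.log (Real.log y) + 13 := by
  linarith [primeSum_le_sum_inv_add_one y, sum_prime_inv_le hy]

theorem exists_half_mul_le_theta : ∃ z₀ : ℝ, 1 ≤ z₀ ∧ ∀ z ≥ z₀, z / 2 ≤ Chebyshev.theta z := by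
  obtain ⟨C, hC⟩ := Chebyshev.psi_sub_theta_le_mul_sqrt
  -- The threshold makes (|C| + 3) √z at most z/20, which fits in the gap between log 2 and 1/2.
  refine ⟨max 100 ((20 * (|C| + 3)) ^ 2), by norm_num, fun z hz => ?_⟩
  have hz1 : 100 ≤ z := (le_max_left _ _).trans hz
  have hz2 : (20 * (|C| + 3)) ^ 2 ≤ z := (le_max_right _ _).trans hz
  have h1 := Chebyshev.psi_ge' (show 0 ≤ z by linarith)
  have h2 := hC z
  have hs : 20 * (|C| + 3) ≤ √z := Real.le_sqrt_of_sq_le hz2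
  have hs0 : 0 ≤ √z := Real.sqrt_nonneg z
  have hsz : √z * √z = z := Real.mul_self_sqrt (by linarith)
  have h3 : C * √z ≤ |C| * √z := mul_le_mul_of_nonneg_right (le_abs_self C) hs0
  have h4 : Real.log (z + 2) ≤ 2 * √z := by
    have e : z + 2 ≤ (√z + 1) ^ 2 := by
      nlinarith [abs_nonneg C]
    calc Real.log (z + 2) ≤ Real.log ((√z + 1) ^ 2) := Real.log_le_log (by linarith) e
      _ = 2 * Real.log (√z + 1) := by rw [Real.log_pow]; norm_num
      _ ≤ 2 * √z := by
        have := Real.log_le_sub_one_of_pos (show 0 < √z + 1 by linarith)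
        linarith
  have h5 := Real.log_two_gt_d9
  have h6 : (20 * (|C| + 3)) * √z ≤ z := by nlinarith
  have h7 : (z - 1) * 0.69 ≤ (z - 1) * Real.log 2 := by
    apply mul_le_mul_of_nonneg_left <;> linarith
  nlinarith [abs_nonneg C]

/-! ### Reciprocal sums over integers with prescribed small primes. -/

/-- The set of primes `p ≤ y` dividing `n`. -/
noncomputable def smallPrimes (n : ℕ) (y : ℝ) : Finset ℕ :=
  n.primeFactors.filter (fun p : ℕ => (p : ℝ) ≤ y)

theorem smallOmega_eq_card (n : ℕ) (y : ℝ) : smallOmega n y = (smallPrimes n y).card := rfl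

theorem mem_smallPrimes {n p : ℕ} {y : ℝ} :
    p ∈ smallPrimes n y ↔ (p.Prime ∧ p ∣ n ∧ n ≠ 0) ∧ (p : ℝ) ≤ y := by
  rw [smallPrimes, mem_filter, Nat.mem_primeFactors]

theorem smallPrimes_subset_primesLE (n : ℕ) (y : ℝ) :
    smallPrimes n y ⊆ Nat.primesLE ⌊y⌋₊ := by
  intro p hp
  rw [mem_smallPrimes] at hp
  rw [Nat.mem_primesLE]
  exact ⟨Nat.le_floor hp.2, hp.1.1⟩

theorem smallPrimes_mul {m n : ℕ} (hm : m ≠ 0) (hn : n ≠ 0) (y : ℝ) :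
    smallPrimes (m * n) y = smallPrimes m y ∪ smallPrimes n y := by
  rw [smallPrimes, Nat.primeFactors_mul hm hn, filter_union]
  rfl

/-- The sum of `1 / n` over the positive integers `n ≤ x` with `ν(n, y) = k`. -/
noncomputable def recipSum (k : ℕ) (x y : ℝ) : ℝ :=
  ∑ n ∈ Icc 1 ⌊x⌋₊ with smallOmega n y = k, (n : ℝ)⁻¹

theorem recipSum_nonneg (k : ℕ) (x y : ℝ) : 0 ≤ recipSum k x y :=
  sum_nonneg fun _ _ => by positivity

/-- Each n is a = ∏ A times an integer with prime factors in A ∪ Q. For p ∈ A, the factor 1/p from a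
and the Euler factor combine to 1/(p - 1). -/
theorem sum_inv_smallPrimes_eq_le {x y : ℝ} (F A : Finset ℕ) (hF : F ⊆ Icc 1 ⌊x⌋₊)
    (hFA : ∀ n ∈ F, smallPrimes n y = A) (hA : A ⊆ Nat.primesLE ⌊y⌋₊) :
    ∑ n ∈ F, (n : ℝ)⁻¹ ≤ (∏ p ∈ A, 1 / ((p : ℝ) - 1)) *
      ∏ p ∈ Nat.primesLE ⌊x⌋₊ \ Nat.primesLE ⌊y⌋₊, (1 - (p : ℝ)⁻¹)⁻¹ := by
  set Q := Nat.primesLE ⌊x⌋₊ \ Nat.primesLE ⌊y⌋₊ with hQ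
  have hAp : ∀ p ∈ A, p.Prime := fun p hp => Nat.prime_of_mem_primesLE (hA hp)
  have hQp : ∀ p ∈ Q, p.Prime := fun p hp => Nat.prime_of_mem_primesLE (mem_sdiff.1 hp).1
  have hdisj : Disjoint A Q := by
    rw [Finset.disjoint_left]
    exact fun p hp hpQ => (mem_sdiff.1 hpQ).2 (hA hp)
  have hAQ : ∀ p ∈ A ∪ Q, p.Prime := by
    intro p hp
    rcases mem_union.1 hp with h | h
    exacts [hAp p h, hQp p h]
  set a := ∏ p ∈ A, p with ha
  have ha0 : 0 < a := prod_pos fun p hp => (hAp p hp).pos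
  have hdvd : ∀ n ∈ F, a ∣ n := by
    intro n hn
    refine Finset.prod_primes_dvd n (fun p hp => (hAp p hp).prime) fun p hp => ?_
    rw [← hFA n hn, mem_smallPrimes] at hp
    exact hp.1.2.1
  have h1 : ∑ n ∈ F, (n : ℝ)⁻¹ = (a : ℝ)⁻¹ * ∑ m ∈ F.image (fun n => n / a), (m : ℝ)⁻¹ := by
    rw [sum_image, mul_sum]
    · refine sum_congr rfl fun n hn => ?_
      obtain ⟨m, rfl⟩ := hdvd n hn
      rw [Nat.mul_div_cancel_left _ ha0]
      push_cast
      rw [mul_inv]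
    · intro m hm n hn hmn
      exact (Nat.div_left_inj (hdvd m hm) (hdvd n hn)).1 hmn
  have h2 := sum_inv_le_prod_of_factoredNumbers (A ∪ Q) hAQ (F.image (fun n => n / a)) (by
    intro m hm
    obtain ⟨n, hn, rfl⟩ := mem_image.1 hm
    have hnI := mem_Icc.1 (hF hn)
    obtain ⟨m, hm⟩ := hdvd n hn
    have hm0 : m ≠ 0 := by
      rintro rfl
      omega
    have hdiv : n / a = m := by rw [hm, Nat.mul_div_cancel_left _ ha0]
    simp only [hdiv]
    refine Nat.mem_factoredNumbers_of_primeFactors_subset hm0 fun p hp => ?_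
    have hpp := Nat.prime_of_mem_primeFactors hp
    have hpn : p ∣ n := hm ▸ (Nat.dvd_of_mem_primeFactors hp).mul_left a
    have hpx : p ≤ ⌊x⌋₊ := (Nat.le_of_dvd hnI.1 hpn).trans hnI.2
    rw [mem_union]
    by_cases hpy : p ≤ ⌊y⌋₊
    · left
      rw [← hFA n hn, mem_smallPrimes]
      exact ⟨⟨hpp, hpn, by omega⟩, (Nat.le_floor_iff' hpp.ne_zero).1 hpy⟩
    · right
      rw [hQ, mem_sdiff, Nat.mem_primesLE, Nat.mem_primesLE]
      exact ⟨⟨hpx, hpp⟩, fun h => hpy h.1⟩)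
  rw [h1]
  refine (mul_le_mul_of_nonneg_left h2 (by positivity)).trans (le_of_eq ?_)
  rw [prod_union hdisj, ← mul_assoc]
  congr 1
  rw [ha, Nat.cast_prod, ← prod_inv_distrib, ← prod_mul_distrib]
  refine prod_congr rfl fun p hp => ?_
  have h1 : (1 : ℝ) < p := by exact_mod_cast (hAp p hp).one_lt
  have : (p : ℝ) - 1 ≠ 0 := by linarith
  field_simp

theorem recipSum_le {x y : ℝ} (hyx : y ≤ x) (k : ℕ) :
    recipSum k x y ≤ elemSymm (Nat.primesLE ⌊y⌋₊) (fun p => 1 / ((p : ℝ) - 1)) k *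
      Real.exp (primeSum x - primeSum y) := by
  have hsub : Nat.primesLE ⌊y⌋₊ ⊆ Nat.primesLE ⌊x⌋₊ := by
    intro p hp
    rw [Nat.mem_primesLE] at hp ⊢
    exact ⟨hp.1.trans (Nat.floor_mono hyx), hp.2⟩
  have hexp : ∏ p ∈ Nat.primesLE ⌊x⌋₊ \ Nat.primesLE ⌊y⌋₊, (1 - (p : ℝ)⁻¹)⁻¹
      ≤ Real.exp (primeSum x - primeSum y) := by
    refine (prod_inv_one_sub_inv_le_exp _ fun p hp =>
      Nat.prime_of_mem_primesLE (mem_sdiff.1 hp).1).trans (le_of_eq ?_)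
    rw [primeSum, primeSum, ← sum_sdiff hsub]
    congr 1; ring
  rw [recipSum, elemSymm, sum_mul]
  rw [← sum_fiberwise_of_maps_to (t := (Nat.primesLE ⌊y⌋₊).powersetCard k)
    (g := fun n => smallPrimes n y)]
  · refine sum_le_sum fun A hA => ?_
    have hA := mem_powersetCard.1 hA
    refine (sum_inv_smallPrimes_eq_le (x := x) (y := y) _ A
      ((filter_subset _ _).trans (filter_subset _ _))
      (fun n hn => (mem_filter.1 hn).2) hA.1).trans ?_
    refine mul_le_mul_of_nonneg_left hexp (prod_nonneg fun p hp => ?_)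
    have h1 : (1 : ℝ) < p := by exact_mod_cast Nat.one_lt_of_mem_primesLE (hA.1 hp)
    have : 0 < (p : ℝ) - 1 := by linarith
    positivity
  · intro n hn
    rw [mem_powersetCard]
    exact ⟨smallPrimes_subset_primesLE n y, (mem_filter.1 hn).2⟩

theorem recipSum_le_of_exp_le {x y : ℝ} (hy : Real.exp 1 ≤ y) (hyx : y ≤ x) (k : ℕ) :
    recipSum k x y ≤ (Real.log (Real.log y) + 13) ^ k / k.factorial *
      (Real.exp 13 * (Real.log x / Real.log y)) := by
  have hy1 : 1 < y := by linarith [Real.add_one_lt_exp (x := 1) (by norm_num)]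
  have hly : 0 < Real.log y := Real.log_pos hy1
  have hlx : 0 < Real.log x := Real.log_pos (by linarith)
  have hnn : ∀ p ∈ Nat.primesLE ⌊y⌋₊, 0 ≤ 1 / ((p : ℝ) - 1) := by
    intro p hp
    have h1 : (1 : ℝ) < p := by exact_mod_cast Nat.one_lt_of_mem_primesLE hp
    have : 0 < (p : ℝ) - 1 := by linarith
    positivity
  refine (recipSum_le hyx k).trans ?_
  refine mul_le_mul ?_ ?_ (Real.exp_pos _).le ?_
  · rw [le_div_iff₀ (by positivity), mul_comm]
    refine (factorial_mul_elemSymm_le _ _ hnn k).trans ?_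
    exact pow_le_pow_left₀ (sum_nonneg hnn) (primeSum_le hy) k
  · rw [← Real.exp_log (div_pos hlx hly), Real.log_div hlx.ne' hly.ne', ← Real.exp_add]
    apply Real.exp_le_exp.2
    linarith [primeSum_le (hy.trans hyx), log_log_le_primeSum hy1]
  · have : 0 ≤ Real.log (Real.log y) := Real.log_nonneg (by
      rwa [Real.le_log_iff_exp_le (by linarith)])
    positivity

/-! ### From reciprocal sums to counts: the upper bound. -/

theorem sum_log_eq_sum_vonMangoldt {x : ℝ} (F : Finset ℕ) (hF : F ⊆ Icc 1 ⌊x⌋₊) :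
    ∑ n ∈ F, Real.log n = ∑ m ∈ Icc 1 ⌊x⌋₊,
      ∑ d ∈ Ioc 0 ⌊x / m⌋₊ with d * m ∈ F, ArithmeticFunction.vonMangoldt d := by
  have h1 : ∑ n ∈ F, Real.log n
      = ∑ n ∈ F, ∑ i ∈ n.divisorsAntidiagonal, ArithmeticFunction.vonMangoldt i.1 := by
    refine sum_congr rfl fun n _ => ?_
    rw [Nat.sum_divisorsAntidiagonal (fun d _ => ArithmeticFunction.vonMangoldt d),
      ArithmeticFunction.vonMangoldt_sum]
  rw [h1, sum_sigma', sum_sigma']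
  refine sum_bij' (fun a _ => ⟨a.2.2, a.2.1⟩) (fun b _ => ⟨b.2 * b.1, (b.2, b.1)⟩) ?_ ?_ ?_ ?_ ?_
  · rintro ⟨n, d, m⟩ h
    simp only [mem_sigma, Nat.mem_divisorsAntidiagonal] at h
    obtain ⟨hn, rfl, h0⟩ := h
    have hI := mem_Icc.1 (hF hn)
    have hm : 0 < m := Nat.pos_of_ne_zero fun h => by simp [h] at h0
    have hd : 0 < d := Nat.pos_of_ne_zero fun h => by simp [h] at h0
    simp only [mem_sigma, mem_Icc, mem_filter, mem_Ioc, Nat.floor_div_natCast]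
    refine ⟨⟨hm, (Nat.le_mul_of_pos_left m hd).trans hI.2⟩, ⟨hd, ?_⟩, hn⟩
    rw [Nat.le_div_iff_mul_le hm]
    exact hI.2
  · rintro ⟨m, d⟩ h
    simp only [mem_sigma, mem_Icc, mem_filter, mem_Ioc] at h
    simp only [mem_sigma, Nat.mem_divisorsAntidiagonal]
    exact ⟨h.2.2, trivial, (Nat.mul_pos h.2.1.1 h.1.1).ne'⟩
  · rintro ⟨n, d, m⟩ h
    simp only [mem_sigma, Nat.mem_divisorsAntidiagonal] at h
    obtain ⟨hn, rfl, h0⟩ := h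
    rfl
  · rintro ⟨m, d⟩ h
    rfl
  · rintro ⟨n, d, m⟩ h
    rfl

theorem smallOmega_le_of_isPrimePow_mul {d m : ℕ} (hd : IsPrimePow d) (hm : m ≠ 0) (y : ℝ) :
    smallOmega m y = smallOmega (d * m) y ∨ smallOmega m y + 1 = smallOmega (d * m) y := by
  have h1 : smallPrimes (d * m) y = smallPrimes d y ∪ smallPrimes m y :=
    smallPrimes_mul hd.ne_zero hm y
  have h2 : (smallPrimes d y).card ≤ 1 := by
    obtain ⟨p, j, hp, hj, rfl⟩ := hd
    refine (card_filter_le _ _).trans ?_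
    rw [Nat.primeFactors_pow _ hj.ne', hp.nat_prime.primeFactors]
    simp
  have h3 : smallOmega m y ≤ smallOmega (d * m) y := by
    rw [smallOmega_eq_card, smallOmega_eq_card, h1]
    exact card_le_card subset_union_right
  have h4 : smallOmega (d * m) y ≤ (smallPrimes d y).card + smallOmega m y := by
    rw [smallOmega_eq_card, smallOmega_eq_card, h1]
    exact card_union_le _ _
  omega

/-- Only cofactors m with ν(m, y) equal to k or k + 1 occur, and each contributes at most ψ(x/m). -/
theorem sum_log_le_recipSum {x y : ℝ} (hx : 0 ≤ x) (k : ℕ) :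
    ∑ n ∈ Icc 1 ⌊x⌋₊ with smallOmega n y = k + 1, Real.log n
      ≤ (Real.log 4 + 4) * x * (recipSum (k + 1) x y + recipSum k x y) := by
  rw [sum_log_eq_sum_vonMangoldt (x := x) _ (filter_subset _ _)]
  have hC : 0 ≤ (Real.log 4 + 4) * x := by
    have : 0 ≤ Real.log 4 := Real.log_nonneg (by norm_num)
    positivity
  have h1 : ∀ m ∈ Icc 1 ⌊x⌋₊,
      ∑ d ∈ Ioc 0 ⌊x / m⌋₊ with d * m ∈ (Icc 1 ⌊x⌋₊).filter (fun n => smallOmega n y = k + 1),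
        ArithmeticFunction.vonMangoldt d
      ≤ (Real.log 4 + 4) * x * ((if smallOmega m y = k + 1 then (m : ℝ)⁻¹ else 0)
        + (if smallOmega m y = k then (m : ℝ)⁻¹ else 0)) := by
    intro m hm
    have hm0 : m ≠ 0 := by have := (mem_Icc.1 hm).1; omega
    have hm' : (0 : ℝ) ≤ (m : ℝ)⁻¹ := by positivity
    by_cases h : smallOmega m y = k + 1 ∨ smallOmega m y = k
    · calc _ ≤ Chebyshev.psi (x / m) :=
            sum_le_sum_of_subset_of_nonneg (filter_subset _ _)
              fun _ _ _ => ArithmeticFunction.vonMangoldt_nonneg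
        _ ≤ (Real.log 4 + 4) * (x / m) := Chebyshev.psi_le_const_mul_self (by positivity)
        _ = (Real.log 4 + 4) * x * (m : ℝ)⁻¹ := by ring
        _ ≤ _ := by
          refine mul_le_mul_of_nonneg_left ?_ hC
          rcases h with h | h <;> simp [h]
    · have hz : ∑ d ∈ Ioc 0 ⌊x / m⌋₊ with
          d * m ∈ (Icc 1 ⌊x⌋₊).filter (fun n => smallOmega n y = k + 1),
          ArithmeticFunction.vonMangoldt d = 0 := by
        refine sum_eq_zero fun d hd => ?_
        rw [ArithmeticFunction.vonMangoldt_eq_zero_iff]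
        intro hpp
        have h2 := (mem_filter.1 (mem_filter.1 hd).2).2
        have := smallOmega_le_of_isPrimePow_mul hpp hm0 y
        omega
      rw [hz]
      refine mul_nonneg hC (add_nonneg ?_ ?_) <;> split_ifs <;> first | exact hm' | exact le_rfl
  refine (sum_le_sum h1).trans (le_of_eq ?_)
  rw [← mul_sum, sum_add_distrib, ← sum_filter, ← sum_filter]
  rfl

/-- Splits log x = log(x/n) + log n and uses log(x/n) ≤ x/n. -/
theorem localCount_mul_log_le {x y : ℝ} (hx : 1 ≤ x) (k : ℕ) :
    (localCount (k + 1) x y : ℝ) * Real.log x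
      ≤ x * recipSum (k + 1) x y
        + (Real.log 4 + 4) * x * (recipSum (k + 1) x y + recipSum k x y) := by
  have hx0 : 0 < x := by linarith
  have h1 : (localCount (k + 1) x y : ℝ) * Real.log x
      = ∑ n ∈ Icc 1 ⌊x⌋₊ with smallOmega n y = k + 1, (Real.log (x / n) + Real.log n) := by
    rw [localCount, ← nsmul_eq_mul, ← sum_const]
    refine sum_congr rfl fun n hn => ?_
    have hn0 : (0 : ℝ) < n := by exact_mod_cast (mem_Icc.1 (mem_filter.1 hn).1).1
    rw [Real.log_div hx0.ne' hn0.ne']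
    ring
  rw [h1, sum_add_distrib]
  refine add_le_add ?_ (sum_log_le_recipSum hx0.le k)
  rw [recipSum, mul_sum]
  refine sum_le_sum fun n hn => ?_
  have hn0 : (0 : ℝ) < n := by exact_mod_cast (mem_Icc.1 (mem_filter.1 hn).1).1
  have := Real.log_le_sub_one_of_pos (div_pos hx0 hn0)
  rw [← div_eq_mul_inv]
  linarith

theorem add_pow_le_pow_mul_exp {L C κ : ℝ} (hL : 0 < L) (hC : 0 ≤ C) (hκ : 0 < κ) {k : ℕ}
    (hk : (k : ℝ) ≤ L / κ) : (L + C) ^ k ≤ L ^ k * Real.exp (C / κ) := by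
  have h1 : L + C = L * (C / L + 1) := by field_simp; ring
  rw [h1, mul_pow]
  refine mul_le_mul_of_nonneg_left ?_ (by positivity)
  calc (C / L + 1) ^ k ≤ Real.exp (C / L) ^ k :=
        pow_le_pow_left₀ (by positivity) (Real.add_one_le_exp _) k
    _ = Real.exp (k * (C / L)) := by rw [Real.exp_nat_mul]
    _ ≤ Real.exp (C / κ) := by
        apply Real.exp_le_exp.2
        calc (k : ℝ) * (C / L) ≤ L / κ * (C / L) := by gcongr
          _ = C / κ := by field_simp

theorem localCount_le_mul_localMain {κ : ℝ} (hκ : 0 < κ) {x y : ℝ} {k : ℕ}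
    (hyx : y ≤ x) (hy : 2 ≤ y) (hk1 : 1 ≤ k) (hk : (k : ℝ) ≤ Real.log (Real.log y) / κ) :
    (localCount k x y : ℝ) ≤ (8 + 7 / κ) * Real.exp (13 / κ) * Real.exp 13 * localMain k x y := by
  obtain ⟨j, rfl⟩ : ∃ j, k = j + 1 := ⟨k - 1, by omega⟩
  set L := Real.log (Real.log y) with hLdef
  have hkκ : ((j + 1 : ℕ) : ℝ) * κ ≤ L := by rwa [le_div_iff₀ hκ] at hk
  -- As k ≥ 1, the range of k forces L > 0, so y > e and the Mertens bounds apply.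
  have hL : 0 < L := lt_of_lt_of_le (by positivity) hkκ
  have hly0 : 0 < Real.log y := Real.log_pos (by linarith)
  have hly : 1 < Real.log y := by
    rwa [hLdef, Real.log_pos_iff hly0.le] at hL
  have hye : Real.exp 1 ≤ y := by
    rw [← Real.le_log_iff_exp_le (by linarith)]
    exact hly.le
  have hlx : 0 < Real.log x := Real.log_pos (by linarith)
  have hx0 : 0 < x := by linarith
  set E := L + 13 with hE
  have hE0 : 0 < E := by linarith
  set G := Real.exp 13 * (Real.log x / Real.log y) with hG
  have hG0 : 0 ≤ G := by positivity
  set V := E ^ (j + 1) / (j + 1).factorial * G with hV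
  have hV0 : 0 ≤ V := by positivity
  have h1 : recipSum (j + 1) x y ≤ V := recipSum_le_of_exp_le hye hyx (j + 1)
  -- Passing from j + 1 to j multiplies the bound by (j + 1)/E, at most 1/κ since (j + 1) κ ≤ L ≤ E.
  have h2 : recipSum j x y ≤ V / κ := by
    refine (recipSum_le_of_exp_le hye hyx j).trans ?_
    rw [hV, le_div_iff₀ hκ, mul_right_comm]
    refine mul_le_mul_of_nonneg_right ?_ hG0
    rw [div_mul_eq_mul_div, div_le_div_iff₀ (by positivity) (by positivity), Nat.factorial_succ]
    push_cast at hkκ ⊢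
    have hfac : (0 : ℝ) ≤ E ^ j * j.factorial := by positivity
    have := mul_le_mul_of_nonneg_left (show ((j : ℝ) + 1) * κ ≤ E by linarith) hfac
    rw [pow_succ]
    linarith
  have h3 := localCount_mul_log_le (x := x) (y := y) (by linarith) j
  have hlog4 : Real.log 4 ≤ 3 := by
    have := Real.log_le_sub_one_of_pos (show (0 : ℝ) < 4 by norm_num); linarith
  have h4 : (localCount (j + 1) x y : ℝ) * Real.log x ≤ x * V + 7 * x * (V + V / κ) := by
    refine h3.trans ?_
    have hr1 := recipSum_nonneg (j + 1) x y
    have hr2 := recipSum_nonneg j x y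
    gcongr
    linarith
  have h5 : E ^ (j + 1) ≤ L ^ (j + 1) * Real.exp (13 / κ) :=
    add_pow_le_pow_mul_exp hL (by norm_num) hκ hk
  refine le_of_mul_le_mul_right (h4.trans ?_) hlx
  have h6 : V ≤ L ^ (j + 1) * Real.exp (13 / κ) / (j + 1).factorial * G := by
    rw [hV]; gcongr
  calc x * V + 7 * x * (V + V / κ) = x * (8 + 7 / κ) * V := by ring
    _ ≤ x * (8 + 7 / κ) * (L ^ (j + 1) * Real.exp (13 / κ) / (j + 1).factorial * G) := by gcongr
    _ = _ := by
      rw [localMain, hG, ← hLdef]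
      field_simp

/-! ### The lower bound for large y. -/

theorem smallPrimes_prod_mul {y : ℝ} {A : Finset ℕ} (hA : A ⊆ Nat.primesLE ⌊y⌋₊) {b : ℕ}
    (hb0 : b ≠ 0) (hb : ∀ p ∈ Nat.primesLE ⌊y⌋₊, ¬ p ∣ b) :
    smallPrimes ((∏ p ∈ A, p) * b) y = A := by
  have hAp : ∀ p ∈ A, p.Prime := fun p hp => Nat.prime_of_mem_primesLE (hA hp)
  have ha0 : ∏ p ∈ A, p ≠ 0 := prod_ne_zero_iff.2 fun p hp => (hAp p hp).ne_zero
  have h1 : smallPrimes b y = ∅ := by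
    rw [eq_empty_iff_forall_notMem]
    intro p hp
    exact hb p (smallPrimes_subset_primesLE b y hp) (mem_smallPrimes.1 hp).1.2.1
  rw [smallPrimes_mul ha0 hb0, h1, union_empty, smallPrimes, Nat.primeFactors_prod hAp,
    filter_true_of_mem]
  intro p hp
  exact (Nat.le_floor_iff' (hAp p hp).ne_zero).1 (Nat.le_of_mem_primesLE (hA hp))

theorem smallOmega_prime_mul {p m : ℕ} {y : ℝ} (hp : p.Prime) (hpy : y < p) (hm : m ≠ 0) :
    smallOmega (p * m) y = smallOmega m y := by
  have h1 : smallPrimes p y = ∅ := by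
    rw [smallPrimes, hp.primeFactors, filter_eq_empty_iff]
    simpa using hpy
  rw [smallOmega_eq_card, smallOmega_eq_card, smallPrimes_mul hp.ne_zero hm, h1, empty_union]

theorem theta_sub_theta_le_sum {x y : ℝ} {k m : ℕ} (hm : m ∈ Icc 1 ⌊x⌋₊) (hmk : smallOmega m y = k) :
    Chebyshev.theta (x / m) - Chebyshev.theta y
      ≤ ∑ d ∈ Ioc 0 ⌊x / m⌋₊ with d * m ∈ (Icc 1 ⌊x⌋₊).filter (fun n => smallOmega n y = k),
        ArithmeticFunction.vonMangoldt d := by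
  have hm1 : 0 < m := (mem_Icc.1 hm).1
  have hm0 : (0 : ℝ) < m := by exact_mod_cast hm1
  rw [Chebyshev.theta_eq_sum_primesLE, Chebyshev.theta_eq_sum_primesLE, sub_le_iff_le_add]
  calc ∑ p ∈ Nat.primesLE ⌊x / m⌋₊, Real.log p
      ≤ ∑ p ∈ (Nat.primesLE ⌊x / m⌋₊ \ Nat.primesLE ⌊y⌋₊) ∪ Nat.primesLE ⌊y⌋₊, Real.log p := by
        refine sum_le_sum_of_subset_of_nonneg (by simp) fun p _ _ => ?_
        exact Real.log_natCast_nonneg p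
    _ = ∑ p ∈ Nat.primesLE ⌊x / m⌋₊ \ Nat.primesLE ⌊y⌋₊, Real.log p
        + ∑ p ∈ Nat.primesLE ⌊y⌋₊, Real.log p := sum_union sdiff_disjoint
    _ ≤ _ := by
        gcongr ?_ + _
        rw [← sum_congr rfl fun p hp => ArithmeticFunction.vonMangoldt_apply_prime
          (Nat.prime_of_mem_primesLE (mem_sdiff.1 hp).1)]
        refine sum_le_sum_of_subset_of_nonneg (fun p hp => ?_)
          fun _ _ _ => ArithmeticFunction.vonMangoldt_nonneg
        rw [mem_sdiff, Nat.mem_primesLE, Nat.mem_primesLE] at hp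
        obtain ⟨⟨hpx, hpp⟩, hpy⟩ := hp
        have hpy' : y < p := by
          by_contra h
          exact hpy ⟨Nat.le_floor (not_lt.1 h), hpp⟩
        rw [mem_filter, mem_Ioc, mem_filter, mem_Icc]
        refine ⟨⟨hpp.pos, hpx⟩, ⟨Nat.mul_pos hpp.pos hm1, ?_⟩, ?_⟩
        · rw [Nat.floor_div_natCast, Nat.le_div_iff_mul_le hm1] at hpx
          exact hpx
        · rw [smallOmega_prime_mul hpp hpy' hm1.ne', hmk]

/-- For m ≤ x/(K y) one has x/m ≥ 6 y, so θ(y) ≤ 1.5 y is at most half of the lower bound x/(2m) for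
θ(x/m), and x/(4m) survives. -/
theorem mul_recipSum_le_sum_log {x y K z₀ : ℝ} (hx : 0 ≤ x) (hy : 1 ≤ y)
    (hz₀ : ∀ z ≥ z₀, z / 2 ≤ Chebyshev.theta z) (hK : z₀ ≤ K) (hK6 : 6 ≤ K) (k : ℕ) :
    x / 4 * recipSum k (x / (K * y)) y
      ≤ ∑ n ∈ Icc 1 ⌊x⌋₊ with smallOmega n y = k, Real.log n := by
  rw [sum_log_eq_sum_vonMangoldt (x := x) _ (filter_subset _ _), recipSum, mul_sum]
  have hKy : 6 * y ≤ K * y := by gcongr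
  have hKy0 : 0 < K * y := by linarith
  have hsub : (Icc 1 ⌊x / (K * y)⌋₊).filter (fun n => smallOmega n y = k) ⊆ Icc 1 ⌊x⌋₊ := by
    intro n hn
    have := mem_Icc.1 (mem_filter.1 hn).1
    rw [mem_Icc]
    exact ⟨this.1, this.2.trans (Nat.floor_mono (div_le_self hx (by linarith)))⟩
  refine le_trans (sum_le_sum fun m hm => ?_) (sum_le_sum_of_subset_of_nonneg hsub
    fun _ _ _ => sum_nonneg fun _ _ => ArithmeticFunction.vonMangoldt_nonneg)
  refine le_trans ?_ (theta_sub_theta_le_sum (hsub hm) (mem_filter.1 hm).2)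
  have hm1 : 0 < m := (mem_Icc.1 (hsub hm)).1
  have hm0 : (0 : ℝ) < m := by exact_mod_cast hm1
  have hmw : (m : ℝ) ≤ x / (K * y) :=
    (Nat.le_floor_iff' hm1.ne').1 (mem_Icc.1 (mem_filter.1 hm).1).2
  have hz : K * y ≤ x / m := by
    rw [le_div_iff₀ hKy0] at hmw
    rw [le_div_iff₀ hm0]
    linarith
  have h1 := hz₀ (x / m) (by nlinarith)
  have h2 := Chebyshev.theta_le_log4_mul_x (x := y) (by linarith)
  have h3 : Real.log 4 ≤ 1.5 := by
    rw [show (4 : ℝ) = 2 ^ 2 by norm_num, Real.log_pow]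
    have := Real.log_two_lt_d9
    norm_num
    linarith
  have h4 : Real.log 4 * y ≤ 1.5 * y := by gcongr
  have h5 : x / 4 * (m : ℝ)⁻¹ = x / m / 4 := by ring
  rw [h5]
  linarith

/-- The products (∏ A) b are distinct: A is recovered as the set of primes ≤ y, and then b by
division. -/
theorem sum_prod_mul_rough_le_recipSum {w v y : ℝ} (hv : 0 < v) (k : ℕ)
    (𝒜 : Finset (Finset ℕ)) (h𝒜 : ∀ A ∈ 𝒜, A ⊆ Nat.primesLE ⌊y⌋₊ ∧ A.card = k)
    (hprod : ∀ A ∈ 𝒜, ((∏ p ∈ A, p : ℕ) : ℝ) ≤ v) :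
    (∑ A ∈ 𝒜, ∏ p ∈ A, 1 / (p : ℝ)) *
        ∑ b ∈ Icc 1 ⌊w / v⌋₊ with ∀ p ∈ Nat.primesLE ⌊y⌋₊, ¬ p ∣ b, (b : ℝ)⁻¹
      ≤ recipSum k w y := by
  set R := (Icc 1 ⌊w / v⌋₊).filter (fun b => ∀ p ∈ Nat.primesLE ⌊y⌋₊, ¬ p ∣ b) with hR
  have hsm : ∀ A ∈ 𝒜, ∀ b ∈ R, smallPrimes ((∏ p ∈ A, p) * b) y = A := by
    intro A hA b hb
    have hb := mem_filter.1 hb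
    have := (mem_Icc.1 hb.1).1
    exact smallPrimes_prod_mul (h𝒜 A hA).1 (by omega) hb.2
  rw [sum_mul_sum, ← sum_product']
  have h1 : ∑ x ∈ 𝒜 ×ˢ R, (∏ p ∈ x.1, 1 / (p : ℝ)) * (x.2 : ℝ)⁻¹
      = ∑ n ∈ (𝒜 ×ˢ R).image (fun x : Finset ℕ × ℕ => (∏ p ∈ x.1, p) * x.2), (n : ℝ)⁻¹ := by
    rw [sum_image]
    · refine sum_congr rfl fun x _ => ?_
      push_cast
      rw [mul_inv, ← prod_inv_distrib]
      simp
    · rintro ⟨A, b⟩ hAb ⟨A', b'⟩ hAb' h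
      rw [mem_coe, mem_product] at hAb hAb'
      simp only at h hAb hAb'
      have hAA : A = A' := by
        rw [← hsm A hAb.1 b hAb.2, ← hsm A' hAb'.1 b' hAb'.2, h]
      subst hAA
      have : 0 < ∏ p ∈ A, p :=
        prod_pos fun p hp => (Nat.prime_of_mem_primesLE ((h𝒜 A hAb.1).1 hp)).pos
      rw [Nat.eq_of_mul_eq_mul_left this h]
  rw [h1, recipSum]
  refine sum_le_sum_of_subset_of_nonneg (fun n hn => ?_) fun _ _ _ => by positivity
  obtain ⟨⟨A, b⟩, hAb, rfl⟩ := mem_image.1 hn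
  rw [mem_product] at hAb
  simp only at hAb ⊢
  have hbI := mem_Icc.1 (mem_filter.1 hAb.2).1
  have ha0 : 0 < ∏ p ∈ A, p :=
    prod_pos fun p hp => (Nat.prime_of_mem_primesLE ((h𝒜 A hAb.1).1 hp)).pos
  rw [mem_filter, mem_Icc]
  refine ⟨⟨Nat.mul_pos ha0 hbI.1, Nat.le_floor ?_⟩, ?_⟩
  · have hb : (b : ℝ) ≤ w / v := (Nat.le_floor_iff' (by omega)).1 hbI.2
    rw [le_div_iff₀ hv] at hb
    push_cast
    have := hprod A hAb.1
    push_cast at this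
    calc (∏ p ∈ A, (p : ℝ)) * b ≤ v * b := by gcongr
      _ ≤ w := by linarith
  · rw [smallOmega_eq_card, hsm A hAb.1 b hAb.2, (h𝒜 A hAb.1).2]

theorem log_mul_exp_le_sum_rough {w y : ℝ} (hw : 0 ≤ w) :
    Real.log w * Real.exp (-primeSum y)
      ≤ ∑ b ∈ Icc 1 ⌊w⌋₊ with ∀ p ∈ Nat.primesLE ⌊y⌋₊, ¬ p ∣ b, (b : ℝ)⁻¹ := by
  have hp : ∀ p ∈ Nat.primesLE ⌊y⌋₊, p.Prime := fun p hp => Nat.prime_of_mem_primesLE hp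
  have h1 := (log_le_sum_inv hw).trans (sum_inv_le_rough_mul_prod _ hp ⌊w⌋₊)
  have h2 : _ ≤ Real.exp (primeSum y) := prod_inv_one_sub_inv_le_exp _ hp
  rw [Real.exp_neg, ← div_eq_mul_inv, div_le_iff₀ (Real.exp_pos _)]
  refine h1.trans (mul_le_mul_of_nonneg_left h2 (sum_nonneg fun _ _ => by positivity))

theorem elemSymm_ge_half {ι : Type*} [DecidableEq ι] (P : Finset ι) (x : ι → ℝ)
    (hx : ∀ p ∈ P, 0 ≤ x p) {α : ℝ} (k : ℕ)
    (hk : ((k : ℝ) + 1) ≤ α * ∑ p ∈ P, x p) (hQ : (∑ p ∈ P, x p ^ 2) * α ^ 2 ≤ 1) :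
    (∑ p ∈ P, x p) ^ (k + 1) / 2 ≤ ((k + 1).factorial : ℝ) * elemSymm P x (k + 1) := by
  set S := ∑ p ∈ P, x p with hSdef
  set Q := ∑ p ∈ P, x p ^ 2 with hQdef
  have hS : 0 ≤ S := sum_nonneg hx
  have hQ0 : 0 ≤ Q := sum_nonneg fun _ _ => sq_nonneg _
  rcases k with _ | k
  · have h1 : elemSymm P x 1 = S := by
      simp [elemSymm, powersetCard_one, hSdef]
    simp [h1]
    linarith
  · refine le_trans ?_ (factorial_mul_elemSymm_ge P x hx k)
    rw [← hSdef, ← hQdef]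
    have hk' : (k : ℝ) + 2 ≤ α * S := by push_cast at hk; linarith
    have h1 : ((k : ℝ) + 1) * (k + 2) ≤ (α * S) * (α * S) := by
      apply mul_le_mul <;> linarith
    have h2 : Q * (((k : ℝ) + 1) * (k + 2) / 2) ≤ S ^ 2 / 2 := by
      calc Q * (((k : ℝ) + 1) * (k + 2) / 2) ≤ Q * ((α * S) * (α * S) / 2) := by gcongr
        _ = (Q * α ^ 2) * (S ^ 2 / 2) := by ring
        _ ≤ 1 * (S ^ 2 / 2) := by gcongr
        _ = _ := one_mul _
    have h3 := mul_le_mul_of_nonneg_right h2 (pow_nonneg hS k)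
    have e : S ^ (k + 1 + 1) = S ^ 2 * S ^ k := by ring
    have e2 : S ^ (k + 2) = S ^ 2 * S ^ k := by ring
    rw [e]
    linarith

/-- By Markov, the sets with ∑ g > D carry at most a quarter of S^(k+1)/(k+1)!, while all sets
together carry at least half. -/
theorem sum_prod_of_sum_le_ge {ι : Type*} [DecidableEq ι] (P : Finset ι) (x g : ι → ℝ)
    (hx : ∀ p ∈ P, 0 ≤ x p) (hg : ∀ p ∈ P, 0 ≤ g p) {α D : ℝ} (hα : 0 ≤ α) (hD : 0 < D) (k : ℕ)
    (hk : ((k : ℝ) + 1) ≤ α * ∑ p ∈ P, x p) (hQ : (∑ p ∈ P, x p ^ 2) * α ^ 2 ≤ 1)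
    (hW : (∑ p ∈ P, x p * g p) * α ≤ D / 4) :
    (∑ p ∈ P, x p) ^ (k + 1) / (k + 1).factorial / 4
      ≤ ∑ A ∈ P.powersetCard (k + 1) with ∑ p ∈ A, g p ≤ D, ∏ p ∈ A, x p := by
  have h1 := elemSymm_ge_half P x hx k hk hQ
  set S := ∑ p ∈ P, x p with hSdef
  set W := ∑ p ∈ P, x p * g p with hWdef
  have hS : 0 ≤ S := sum_nonneg hx
  have hW0 : 0 ≤ W := sum_nonneg fun p hp => mul_nonneg (hx p hp) (hg p hp)
  have hpx : ∀ A ∈ P.powersetCard (k + 1), 0 ≤ ∏ p ∈ A, x p := fun A hA =>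
    prod_nonneg fun p hp => hx p ((mem_powersetCard.1 hA).1 hp)
  have hbad : D * ∑ A ∈ P.powersetCard (k + 1) with ¬ ∑ p ∈ A, g p ≤ D, ∏ p ∈ A, x p
      ≤ W * elemSymm P x k := by
    refine le_trans ?_ (sum_prod_mul_sum_le P x g hx hg k)
    rw [mul_sum]
    refine le_trans (sum_le_sum (g := fun A => (∏ p ∈ A, x p) * ∑ p ∈ A, g p) fun A hA => ?_)
      (sum_le_sum_of_subset_of_nonneg (filter_subset _ _) fun A hA _ => ?_)
    · rw [mem_filter] at hA
      rw [mul_comm]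
      exact mul_le_mul_of_nonneg_left (not_le.1 hA.2).le (hpx A hA.1)
    · exact mul_nonneg (hpx A hA)
        (sum_nonneg fun p hp => hg p ((mem_powersetCard.1 hA).1 hp))
  have hsplit : elemSymm P x (k + 1)
      = ∑ A ∈ P.powersetCard (k + 1) with ∑ p ∈ A, g p ≤ D, ∏ p ∈ A, x p
        + ∑ A ∈ P.powersetCard (k + 1) with ¬ ∑ p ∈ A, g p ≤ D, ∏ p ∈ A, x p := by
    rw [elemSymm, sum_filter_add_sum_filter_not]
  set good := ∑ A ∈ P.powersetCard (k + 1) with ∑ p ∈ A, g p ≤ D, ∏ p ∈ A, x p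
  set bad := ∑ A ∈ P.powersetCard (k + 1) with ¬ ∑ p ∈ A, g p ≤ D, ∏ p ∈ A, x p
  have h2 := factorial_mul_elemSymm_le P x hx k
  rw [← hSdef] at h2
  have hfac : (0 : ℝ) < (k + 1).factorial := by positivity
  have h3 : ((k + 1).factorial : ℝ) * bad ≤ S ^ (k + 1) / 4 := by
    refine le_of_mul_le_mul_left ?_ hD
    calc D * (((k + 1).factorial : ℝ) * bad) = ((k + 1).factorial : ℝ) * (D * bad) := by ring
      _ ≤ ((k + 1).factorial : ℝ) * (W * elemSymm P x k) := by gcongr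
      _ = W * ((k : ℝ) + 1) * (k.factorial * elemSymm P x k) := by
        rw [Nat.factorial_succ]; push_cast; ring
      _ ≤ W * (α * S) * S ^ k := by
        have := elemSymm_nonneg P x hx k
        gcongr
      _ = (W * α) * S ^ (k + 1) := by ring
      _ ≤ D / 4 * S ^ (k + 1) := by gcongr
      _ = _ := by ring
  rw [div_div, div_le_iff₀ (by positivity)]
  rw [hsplit] at h1
  linarith

theorem sum_inv_primes_gt_ge {z : ℝ} (hz : 1 < z) (T : ℕ) :
    Real.log (Real.log z) - 1 - T ≤ ∑ p ∈ Nat.primesLE ⌊z⌋₊ with T < p, 1 / (p : ℝ) := by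
  have h1 := (log_log_le_primeSum hz).trans (primeSum_le_sum_inv_add_one z)
  rw [← sum_filter_add_sum_filter_not _ (fun p => T < p)] at h1
  have h2 : ∑ p ∈ Nat.primesLE ⌊z⌋₊ with ¬ T < p, 1 / (p : ℝ) ≤ T := by
    calc ∑ p ∈ Nat.primesLE ⌊z⌋₊ with ¬ T < p, 1 / (p : ℝ)
        ≤ ∑ p ∈ Icc 1 T, (1 : ℝ) := by
          refine (sum_le_sum (g := fun _ => (1 : ℝ)) fun p hp => ?_).trans
            (sum_le_sum_of_subset_of_nonneg (fun p hp => ?_) fun _ _ _ => zero_le_one)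
          · have : (1 : ℝ) < p := by
              exact_mod_cast Nat.one_lt_of_mem_primesLE (mem_filter.1 hp).1
            rw [div_le_one (by linarith)]
            exact this.le
          · rw [mem_filter] at hp
            rw [mem_Icc]
            exact ⟨(Nat.one_lt_of_mem_primesLE hp.1).le, not_lt.1 hp.2⟩
      _ = T := by simp
  linarith

theorem sum_inv_sq_primes_gt_le (N : ℕ) {T : ℕ} (hT : 1 ≤ T) :
    ∑ p ∈ Nat.primesLE N with T < p, (1 / (p : ℝ)) ^ 2 ≤ 1 / (T : ℝ) := by
  have hgt : ∀ n ∈ Ioc T N, 0 < (n : ℝ) - 1 := by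
    intro n hn
    have : (1 : ℝ) < n := by exact_mod_cast hT.trans_lt (mem_Ioc.1 hn).1
    linarith
  have hsub : (Nat.primesLE N).filter (fun p => T < p) ⊆ Ioc T N := by
    intro p hp
    rw [mem_filter] at hp
    rw [mem_Ioc]
    exact ⟨hp.2, Nat.le_of_mem_primesLE hp.1⟩
  refine le_trans ((sum_le_sum fun p hp => ?_).trans (sum_le_sum_of_subset_of_nonneg hsub
    fun n hn _ => ?_)) (sum_Ioc_inv_mul_pred_le T N hT)
  · have := hgt p (hsub hp)
    rw [div_pow, one_pow, pow_two]
    apply one_div_le_one_div_of_le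
    · exact mul_pos (by linarith) this
    · apply mul_le_mul_of_nonneg_left <;> linarith
  · have := hgt n hn
    exact one_div_nonneg.2 (mul_nonneg (by linarith) this.le)

theorem exists_sum_prod_inv_ge {c κ : ℝ} (hc : 0 < c) (hκ : 0 < κ) :
    ∃ δ Y : ℝ, 0 < δ ∧ ∀ y : ℝ, Y ≤ y → ∀ k : ℕ,
      (k : ℝ) + 1 ≤ Real.log (Real.log y) / κ → ∃ 𝒜 : Finset (Finset ℕ),
        (∀ A ∈ 𝒜, A ⊆ Nat.primesLE ⌊y⌋₊ ∧ A.card = k + 1) ∧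
        (∀ A ∈ 𝒜, ((∏ p ∈ A, p : ℕ) : ℝ) ≤ y ^ c) ∧
        δ * (Real.log (Real.log y) ^ (k + 1) / (k + 1).factorial)
          ≤ ∑ A ∈ 𝒜, ∏ p ∈ A, 1 / (p : ℝ) := by
  -- With α = 2/κ and D = c log y, the main term ε log y of the weighted sum uses half of the
  -- allowance D/4; the constant 7 uses the other half once log y ≥ 112/(c κ).
  set ε := min 1 (c * κ / 16) with hε
  have hε0 : 0 < ε := lt_min one_pos (by positivity)
  have hε1 : ε ≤ 1 := min_le_left _ _
  have hε2 : ε ≤ c * κ / 16 := min_le_right _ _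
  -- Gives (∑ 1/p²) α² ≤ (1/T)(4/κ²) ≤ 1.
  set T := ⌈4 / κ ^ 2⌉₊ + 1 with hT
  have hT1 : 1 ≤ T := by omega
  have hTκ : 4 / κ ^ 2 ≤ T := by
    rw [hT]; push_cast
    linarith [Nat.le_ceil (4 / κ ^ 2)]
  set C := 1 + T - Real.log ε with hC
  have hC0 : 0 ≤ C := by
    have := Real.log_nonpos hε0.le hε1
    have : (0 : ℝ) ≤ T := Nat.cast_nonneg _
    linarith
  -- The term 2 C ensures S ≥ L - C ≥ L/2, whence k + 1 ≤ L/κ ≤ (2/κ) S.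
  set M := 1 + 112 / (c * κ) + 2 * C with hM
  have hcκ : 0 ≤ 112 / (c * κ) := by positivity
  refine ⟨Real.exp (-(2 * C / κ)) / 4, Real.exp (Real.exp M), by positivity, fun y hy k hk => ?_⟩
  set L := Real.log (Real.log y) with hLdef
  have hy0 : 0 < y := (Real.exp_pos _).trans_le hy
  have hly : Real.exp M ≤ Real.log y := by rwa [Real.le_log_iff_exp_le hy0]
  have hly0 : 0 < Real.log y := (Real.exp_pos _).trans_le hly
  have hLM : M ≤ L := by rwa [hLdef, Real.le_log_iff_exp_le hly0]
  have hlyM : M ≤ Real.log y := by linarith [Real.add_one_le_exp M]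
  have hy1 : 1 < y := by rwa [← Real.log_pos_iff hy0.le]
  have hL0 : 0 < L := by linarith
  set z := y ^ ε with hz
  have hz1 : 1 < z := Real.one_lt_rpow hy1 hε0
  have hlz : Real.log z = ε * Real.log y := Real.log_rpow hy0 ε
  have hllz : Real.log (Real.log z) = Real.log ε + L := by
    rw [hlz, Real.log_mul hε0.ne' hly0.ne']
  have hzy : z ≤ y := by
    calc z ≤ y ^ (1 : ℝ) := Real.rpow_le_rpow_of_exponent_le hy1.le hε1
      _ = y := Real.rpow_one y
  set P := (Nat.primesLE ⌊z⌋₊).filter (fun p => T < p) with hP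
  have hPy : P ⊆ Nat.primesLE ⌊y⌋₊ := by
    intro p hp
    have hp := (mem_filter.1 hp).1
    rw [Nat.mem_primesLE] at hp ⊢
    exact ⟨hp.1.trans (Nat.floor_mono hzy), hp.2⟩
  have hPpos : ∀ p ∈ P, (1 : ℝ) < p := fun p hp => by
    exact_mod_cast Nat.one_lt_of_mem_primesLE (hPy hp)
  set S := ∑ p ∈ P, 1 / (p : ℝ) with hS
  have hSL : L - C ≤ S := by
    have := sum_inv_primes_gt_ge hz1 T
    rw [hllz] at this
    linarith
  have hSL2 : L / 2 ≤ S := by linarith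
  have hQ : ∑ p ∈ P, (1 / (p : ℝ)) ^ 2 ≤ 1 / (T : ℝ) := sum_inv_sq_primes_gt_le _ hT1
  have hW : ∑ p ∈ P, 1 / (p : ℝ) * Real.log p ≤ ε * Real.log y + 7 := by
    have h1 := sum_log_div_le hz1.le
    have h2 : Real.log 4 ≤ 4 - 1 := Real.log_le_sub_one_of_pos (by norm_num)
    rw [hlz] at h1
    refine le_trans (le_trans (le_of_eq ?_) (sum_le_sum_of_subset_of_nonneg
      (filter_subset (fun p => T < p) (Nat.primesLE ⌊z⌋₊))
      fun p _ _ => div_nonneg (Real.log_natCast_nonneg p) (Nat.cast_nonneg p))) (h1.trans ?_)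
    · exact sum_congr rfl fun p _ => by ring
    · linarith
  have hmain := sum_prod_of_sum_le_ge P (fun p => 1 / (p : ℝ)) (fun p => Real.log p)
    (fun p hp => by have := hPpos p hp; positivity) (fun p _ => Real.log_natCast_nonneg p)
    (α := 2 / κ) (D := Real.log y * c) (by positivity) (by positivity) k
    (by
      refine hk.trans ?_
      rw [div_mul_eq_mul_div]
      gcongr
      linarith)
    (by
      calc (∑ p ∈ P, (1 / (p : ℝ)) ^ 2) * (2 / κ) ^ 2 ≤ 1 / T * (2 / κ) ^ 2 := by gcongr
        _ = 4 / κ ^ 2 / T := by ring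
        _ ≤ 1 := by
          rw [div_le_one (by exact_mod_cast hT1)]
          exact hTκ)
    (by
      calc (∑ p ∈ P, 1 / (p : ℝ) * Real.log p) * (2 / κ) ≤ (ε * Real.log y + 7) * (2 / κ) := by
            gcongr
        _ ≤ (c * κ / 16 * Real.log y + c * κ * Real.log y / 16) * (2 / κ) := by
            have : 112 / (c * κ) ≤ Real.log y := by linarith
            rw [div_le_iff₀ (by positivity)] at this
            gcongr
            linarith
        _ = Real.log y * c / 4 := by field_simp; ring)
  refine ⟨(P.powersetCard (k + 1)).filter (fun A => ∑ p ∈ A, Real.log p ≤ Real.log y * c),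
    fun A hA => ?_, fun A hA => ?_, ?_⟩
  · have := mem_powersetCard.1 (mem_filter.1 hA).1
    exact ⟨this.1.trans hPy, this.2⟩
  · rw [mem_filter, mem_powersetCard] at hA
    rw [Real.rpow_def_of_pos hy0]
    calc ((∏ p ∈ A, p : ℕ) : ℝ) = ∏ p ∈ A, Real.exp (Real.log p) := by
          push_cast
          refine prod_congr rfl fun p hp => ?_
          rw [Real.exp_log (by linarith [hPpos p (hA.1.1 hp)])]
      _ = Real.exp (∑ p ∈ A, Real.log p) := (Real.exp_sum _ _).symm
      _ ≤ _ := Real.exp_le_exp.2 hA.2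
  · refine le_trans ?_ hmain
    have h1 : L ^ (k + 1) * Real.exp (-(2 * C / κ)) ≤ S ^ (k + 1) := by
      -- Since L ≥ 2 C, replacing L by S costs a factor exp(2C/L), whose (k+1)-th power is bounded
      -- because k + 1 ≤ L/κ.
      have h2 : L ≤ S * Real.exp (2 * C / L) := by
        have h3 : L ≤ (L - C) * (2 * C / L + 1) := by
          have e : (L - C) * (2 * C / L + 1) = L + C * (L - 2 * C) / L := by
            field_simp; ring
          have : 0 ≤ C * (L - 2 * C) / L := div_nonneg (mul_nonneg hC0 (by linarith)) hL0.le
          linarith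
        refine h3.trans (mul_le_mul hSL (Real.add_one_le_exp _) (by positivity) (by linarith))
      have h3 := pow_le_pow_left₀ hL0.le h2 (k + 1)
      rw [mul_pow, ← Real.exp_nat_mul] at h3
      have h4 : ((k + 1 : ℕ) : ℝ) * (2 * C / L) ≤ 2 * C / κ := by
        push_cast
        calc ((k : ℝ) + 1) * (2 * C / L) ≤ L / κ * (2 * C / L) := by gcongr
          _ = _ := by field_simp
      have hS0 : 0 ≤ S := by linarith
      calc L ^ (k + 1) * Real.exp (-(2 * C / κ))
          ≤ (S ^ (k + 1) * Real.exp (2 * C / κ)) * Real.exp (-(2 * C / κ)) := by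
            gcongr
            refine h3.trans ?_
            gcongr
        _ = S ^ (k + 1) := by rw [mul_assoc, ← Real.exp_add]; simp
    rw [div_mul_div_comm, div_div, mul_comm (4 : ℝ), mul_comm (Real.exp _)]
    gcongr

theorem exists_mul_localMain_le_of_large {c κ : ℝ} (hc0 : 0 < c) (hc1 : c < 1) (hκ : 0 < κ) :
    ∃ A y₀ : ℝ, 0 < A ∧ 2 ≤ y₀ ∧ ∀ (x y : ℝ) (k : ℕ), y₀ ≤ y → y ≤ x → y ≤ x ^ (1 - c) →
      1 ≤ k → (k : ℝ) ≤ Real.log (Real.log y) / κ →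
        A * localMain k x y ≤ (localCount k x y : ℝ) := by
  obtain ⟨δ, Y, hδ, hY⟩ := exists_sum_prod_inv_ge hc0 hκ
  obtain ⟨z₀, hz1, hz₀⟩ := exists_half_mul_le_theta
  set K := max z₀ 6 with hK
  have hK6 : 6 ≤ K := le_max_right _ _
  have hlK : 0 ≤ Real.log K := Real.log_nonneg (by linarith)
  refine ⟨c ^ 2 * δ * Real.exp (-13) / 8,
    max Y (Real.exp (1 + 2 * Real.log K / c ^ 2)), by positivity, ?_, ?_⟩
  · refine le_trans ?_ (le_max_right _ _)
    have : 0 ≤ 2 * Real.log K / c ^ 2 := by positivity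
    linarith [Real.add_one_le_exp (1 + 2 * Real.log K / c ^ 2)]
  intro x y k hy hyx hyc hk1 hk
  obtain ⟨j, rfl⟩ : ∃ j, k = j + 1 := ⟨k - 1, by omega⟩
  have hyY : Y ≤ y := (le_max_left _ _).trans hy
  have hyE : Real.exp (1 + 2 * Real.log K / c ^ 2) ≤ y := (le_max_right _ _).trans hy
  have hy0 : 0 < y := (Real.exp_pos _).trans_le hyE
  have hx0 : 0 < x := hy0.trans_le hyx
  have hly : 1 + 2 * Real.log K / c ^ 2 ≤ Real.log y := by
    rwa [Real.le_log_iff_exp_le hy0]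
  have hKc : 0 ≤ 2 * Real.log K / c ^ 2 := by positivity
  have hye : Real.exp 1 ≤ y := le_trans (Real.exp_le_exp.2 (by linarith)) hyE
  have hly0 : 0 < Real.log y := by linarith
  have hlyx : Real.log y ≤ Real.log x := Real.log_le_log hy0 hyx
  have hlx0 : 0 < Real.log x := by linarith
  have hlyc : Real.log y ≤ (1 - c) * Real.log x := by
    rw [← Real.log_rpow hx0]
    exact Real.log_le_log hy0 hyc
  have hL0 : 0 ≤ Real.log (Real.log y) := Real.log_nonneg (by linarith)
  obtain ⟨𝒜, h𝒜1, h𝒜2, h𝒜3⟩ := hY y hyY j (by exact_mod_cast hk)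
  have hyc0 : 0 < y ^ c := Real.rpow_pos_of_pos hy0 c
  set w := x / (K * y) with hw
  have hw0 : 0 < w := by positivity
  -- Here y ≤ x^(1-c) enters: removing y^(1+c) from x leaves at least 1 - (1-c)(1+c) = c² of log x,
  -- and half of that absorbs log K.
  have hlw : c ^ 2 / 2 * Real.log x ≤ Real.log (w / y ^ c) := by
    rw [Real.log_div hw0.ne' hyc0.ne', hw, Real.log_div hx0.ne' (by positivity),
      Real.log_mul (by positivity) hy0.ne', Real.log_rpow hy0]
    have h1 : (1 + c) * Real.log y ≤ (1 + c) * ((1 - c) * Real.log x) := by gcongr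
    have h2 : 2 * Real.log K / c ^ 2 ≤ Real.log x := by linarith
    rw [div_le_iff₀ (by positivity)] at h2
    linarith
  have hlw0 : 0 ≤ Real.log (w / y ^ c) := le_trans (by positivity) hlw
  have hR := log_mul_exp_le_sum_rough (y := y) (div_pos hw0 hyc0).le
  have hexp : Real.exp (-13) / Real.log y ≤ Real.exp (-primeSum y) := by
    have : Real.exp (-13) / Real.log y = Real.exp (-13 - Real.log (Real.log y)) := by
      rw [Real.exp_sub, Real.exp_log hly0]
    rw [this]
    exact Real.exp_le_exp.2 (by linarith [primeSum_le hye])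
  have h1 := sum_prod_mul_rough_le_recipSum (w := w) hyc0 (j + 1) 𝒜 h𝒜1 h𝒜2
  have hy1 : 1 ≤ y := by linarith [Real.add_one_le_exp 1]
  have h2 := mul_recipSum_le_sum_log (x := x) (y := y) hx0.le hy1 hz₀ (le_max_left z₀ 6) hK6
    (j + 1)
  have h3 : ∑ n ∈ Icc 1 ⌊x⌋₊ with smallOmega n y = j + 1, Real.log n
      ≤ (localCount (j + 1) x y : ℝ) * Real.log x := by
    rw [localCount, ← nsmul_eq_mul, ← sum_const]
    refine sum_le_sum fun n hn => ?_
    have hn := mem_Icc.1 (mem_filter.1 hn).1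
    exact Real.log_le_log (by exact_mod_cast hn.1) ((Nat.le_floor_iff' (by omega)).1 hn.2)
  refine le_of_mul_le_mul_right (le_trans ?_ (h2.trans h3)) hlx0
  calc c ^ 2 * δ * Real.exp (-13) / 8 * localMain (j + 1) x y * Real.log x
      = x / 4 * ((δ * (Real.log (Real.log y) ^ (j + 1) / (j + 1).factorial)) *
          (c ^ 2 / 2 * Real.log x * (Real.exp (-13) / Real.log y))) := by
        rw [localMain]; field_simp; ring
    _ ≤ x / 4 * ((∑ A ∈ 𝒜, ∏ p ∈ A, 1 / (p : ℝ)) *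
          (Real.log (w / y ^ c) * Real.exp (-primeSum y))) := by gcongr
    _ ≤ x / 4 * ((∑ A ∈ 𝒜, ∏ p ∈ A, 1 / (p : ℝ)) *
          ∑ b ∈ Icc 1 ⌊w / y ^ c⌋₊ with ∀ p ∈ Nat.primesLE ⌊y⌋₊, ¬ p ∣ b, (b : ℝ)⁻¹) := by gcongr
    _ ≤ x / 4 * recipSum (j + 1) w y := by gcongr

/-! ### Bounded y, and the conclusion. -/

/-- From L^k / k! ≤ exp L = log y. For bounded y it therefore suffices to compare the count with x.
-/
theorem localMain_le {x y : ℝ} (hx : 0 ≤ x) (hy : 1 < y) (hL : 0 ≤ Real.log (Real.log y)) (k : ℕ) :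
    localMain k x y ≤ x := by
  have hly : 0 < Real.log y := Real.log_pos hy
  rw [localMain, div_le_iff₀ (by positivity)]
  have h := Real.pow_div_factorial_le_exp _ hL k
  rw [Real.exp_log hly, div_le_iff₀ (by positivity)] at h
  calc _ ≤ x * (Real.log y * k.factorial) := by gcongr
    _ = _ := by ring

/-- If a is the product of the primes ≤ y dividing one solution, every a (1 + Q j) has the same
primes ≤ y, because 1 + Q j is prime to Q. -/
theorem exists_mul_le_localCount_of_bounded (y₀ : ℝ) :
    ∃ A : ℝ, 0 < A ∧ ∀ (x y : ℝ) (k : ℕ), 0 ≤ x → y ≤ y₀ → 1 ≤ localCount k x y →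
      A * x ≤ (localCount k x y : ℝ) := by
  set Q := ∏ p ∈ Nat.primesLE ⌊y₀⌋₊, p with hQ
  have hQ0 : 0 < Q := prod_pos fun p hp => (Nat.prime_of_mem_primesLE hp).pos
  have hQ0' : (0 : ℝ) < Q := by exact_mod_cast hQ0
  refine ⟨1 / (Q * (Q + 1)), by positivity, fun x y k hx hy hN => ?_⟩
  obtain ⟨n, hn⟩ := card_pos.1 hN
  rw [mem_filter, mem_Icc] at hn
  set B := smallPrimes n y with hB
  have hBy : B ⊆ Nat.primesLE ⌊y⌋₊ := smallPrimes_subset_primesLE n y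
  have hyy₀ : Nat.primesLE ⌊y⌋₊ ⊆ Nat.primesLE ⌊y₀⌋₊ := by
    intro p hp
    rw [Nat.mem_primesLE] at hp ⊢
    exact ⟨hp.1.trans (Nat.floor_mono hy), hp.2⟩
  set a := ∏ p ∈ B, p with ha
  have ha0 : 0 < a := prod_pos fun p hp => (Nat.prime_of_mem_primesLE (hBy hp)).pos
  have ha0' : (0 : ℝ) < a := by exact_mod_cast ha0
  have haQ : a ≤ Q := Nat.le_of_dvd hQ0 (prod_dvd_prod_of_subset _ _ _ (hBy.trans hyy₀))
  have han : a ≤ n := by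
    refine Nat.le_of_dvd hn.1.1 (Finset.prod_primes_dvd n (fun p hp => ?_) fun p hp => ?_)
    · exact (mem_smallPrimes.1 hp).1.1.prime
    · exact (mem_smallPrimes.1 hp).1.2.1
  have hax : (a : ℝ) ≤ x := by
    have h1 : (n : ℝ) ≤ x := (Nat.le_floor_iff' (by omega)).1 hn.1.2
    have h2 : (a : ℝ) ≤ n := by exact_mod_cast han
    linarith
  have ht : 1 ≤ x / a := by rwa [one_le_div ha0']
  set J := ⌊(x / a - 1) / Q⌋₊ with hJ
  -- The index j = 0 is included, so the bound holds even when x is barely larger than a.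
  have hcard : J + 1 ≤ localCount k x y := by
    rw [localCount, ← card_range (J + 1)]
    refine card_le_card_of_injOn (fun j => a * (1 + Q * j)) (fun j hj => ?_) ?_
    · rw [mem_coe, mem_range, Nat.lt_succ_iff, hJ, Nat.le_floor_iff (by
        exact div_nonneg (by linarith) hQ0'.le), le_div_iff₀ hQ0', le_sub_iff_add_le,
        le_div_iff₀ ha0'] at hj
      rw [mem_coe, mem_filter, mem_Icc]
      refine ⟨⟨Nat.mul_pos ha0 (by omega), Nat.le_floor ?_⟩, ?_⟩
      · push_cast
        linarith
      · rw [smallOmega_eq_card, smallPrimes_prod_mul hBy (by omega)]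
        · exact hn.2
        · intro p hp hdvd
          have h1 : p ∣ Q * j := (dvd_prod_of_mem _ (hyy₀ hp)).mul_right j
          exact (Nat.prime_of_mem_primesLE hp).one_lt.ne'
            (Nat.dvd_one.1 ((Nat.dvd_add_left h1).1 hdvd))
    · intro i _ j _ hij
      have h1 := Nat.eq_of_mul_eq_mul_left ha0 hij
      exact Nat.eq_of_mul_eq_mul_left hQ0 (by omega)
  have hcard' : (J : ℝ) + 1 ≤ localCount k x y := by exact_mod_cast hcard
  have hJ1 : (x / a - 1) / Q < J + 1 := Nat.lt_floor_add_one _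
  have hJ0 : (0 : ℝ) ≤ J := Nat.cast_nonneg _
  have h1 : x / a ≤ (J + 1) * (Q + 1) := by
    rw [div_lt_iff₀ hQ0'] at hJ1
    linarith
  have haQ' : (a : ℝ) ≤ Q := by exact_mod_cast haQ
  refine le_trans ?_ hcard'
  rw [div_le_iff₀ ha0'] at h1
  rw [div_mul_eq_mul_div, one_mul, div_le_iff₀ (by positivity)]
  calc x ≤ (J + 1) * (Q + 1) * a := h1
    _ ≤ (J + 1) * (Q + 1) * Q := by gcongr
    _ = _ := by ring

theorem theorem1p4 (c κ : ℝ) (hc0 : 0 < c) (hc1 : c < 1) (hκ : 0 < κ) :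
    ∃ A B y₀ : ℝ, 0 < A ∧ 0 < B ∧ 2 ≤ y₀ ∧
      ∀ (x y : ℝ) (k : ℕ), 2 ≤ y → y ≤ x → y ≤ x ^ (1 - c) →
        1 ≤ k → (k : ℝ) ≤ Real.log (Real.log y) / κ →
          (localCount k x y : ℝ) ≤ B * localMain k x y ∧
          ((y₀ ≤ y ∨ 1 ≤ localCount k x y) →
            A * localMain k x y ≤ (localCount k x y : ℝ)) := by
  obtain ⟨A₁, y₀, hA₁, hy₀, h₁⟩ := exists_mul_localMain_le_of_large hc0 hc1 hκ
  obtain ⟨A₂, hA₂, h₂⟩ := exists_mul_le_localCount_of_bounded y₀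
  refine ⟨min A₁ A₂, (8 + 7 / κ) * Real.exp (13 / κ) * Real.exp 13, y₀, lt_min hA₁ hA₂,
    by positivity, hy₀, fun x y k hy hyx hyc hk1 hk =>
      ⟨localCount_le_mul_localMain hκ hyx hy hk1 hk, fun h => ?_⟩⟩
  have hx0 : 0 ≤ x := by linarith
  have hL : 0 ≤ Real.log (Real.log y) := by
    rw [le_div_iff₀ hκ] at hk
    exact le_trans (by positivity) hk
  have hm0 : 0 ≤ localMain k x y := by
    have : 0 < Real.log y := Real.log_pos (by linarith)
    rw [localMain]
    positivity
  rcases le_total y₀ y with hle | hle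
  · exact (mul_le_mul_of_nonneg_right (min_le_left _ _) hm0).trans
      (h₁ x y k hle hyx hyc hk1 hk)
  · by_cases hN : 1 ≤ localCount k x y
    · calc min A₁ A₂ * localMain k x y ≤ A₂ * x :=
            mul_le_mul (min_le_right _ _) (localMain_le hx0 (by linarith) hL k) hm0 hA₂.le
        _ ≤ _ := h₂ x y k hx0 hle hN
    · exact (mul_le_mul_of_nonneg_right (min_le_left _ _) hm0).trans
        (h₁ x y k (h.resolve_right hN) hyx hyc hk1 hk)
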